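/- Setting. Let $\|\cdot\|$ be any norm on $\mathbb{R}^n$, with dual norm $\|y\|_*=\max\{\langle y,x\rangle:\|x\|\le 1\}$. Let $\mathcal X=\{x\in\mathbb{R}^n_+ : Ax=c\}$ with $A\in\mathbb{R}^{m\times n}$, $c\in\mathbb{R}^m$, and assume that $\mathcal X$ contains a point with all coordinates positive. Let $v:\mathcal X\to\mathbb{R}^n$ satisfy $\|v(x')-v(x)\|_*\le L\|x'-x\|$ on $\mathcal X$, with $L>0$. Let $x^*\in\mathcal X$ satisfy $\langle v(x^*),x-x^*\rangle\ge 0$ for all $x\in\mathcal X$, and suppose that there are $\mu>0$ and a convex neighborhood $\mathcal B$ of $x^*$ in $\mathcal X$ with $\langle v(x)-v(x^*),x-x^*\rangle\ge\mu\|x-x^*\|^2$ for all $x\in\mathcal B$. Regularizer. Let $h:\mathbb{R}^n\to\mathbb{R}\cup\{\infty\}$ be proper, lower semicontinuous and strictly convex with $\operatorname{dom}h=\mathcal X$; suppose that $\partial h$ has a continuous selection $\nabla h$ on $\operatorname{dom}\partial h$, and that $h(x')\ge h(x)+\langle\nabla h(x),x'-x\rangle+\tfrac12\|x'-x\|^2$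 for all $x\in\operatorname{dom}\partial h$, $x'\in\mathcal X$. Suppose that $h(x)=\sum_{i=1}^n\theta(x_i)$ on $\mathcal X$, where $\theta:\mathbb{R}_+\to\mathbb{R}$ is continuous, and on $(0,\infty)$ it is twice differentiable with $\theta''>0$ and $\theta''$ locally Lipschitz. Put $D(p,x)=h(p)-h(x)-\langle\nabla h(x),p-x\rangle$ and $P_x(y)=\arg\min_{x'\in\mathcal X}\{\langle y,x-x'\rangle+D(x',x)\}$. Method. Let $a,b\in[0,1]$ with $a+b\le 1$, and $a+b=1$ if $b>0$. Let $\gamma>0$ satisfy $\gamma\le 1/(2\varphi L)$, where $\varphi=(1+\sqrt5)/2$, and $\gamma(1-a-b)^2\le\mu/(8L^2)$. From $X_1=X_{1/2}\in\operatorname{dom}\partial h$, define for $t=1,2,\dots$ $$X_{t+1/2}=P_{X_t}\bigl(-\gamma\,[a\,v(X_t)+b\,v(X_{t-1/2})]\bigr),\qquad X_{t+1}=P_{X_t}\bigl(-\gamma\, v(X_{t+1/2})\bigr).$$ Sharpness. Let $\mathcal A=\{i:x^*_i=0\}$ and let $s_i\ge0$ ($i\in\mathcal A$) be slackness coefficients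 at $x^*$, i.e. $v(x^*)-\sum_{i\in\mathcal A}s_ie_i$ belongs to the row space of $A$. Assume that $x^*$ is sharp, i.e. it is an extreme point of $\mathcal X$ and $s_i>0$ for all $i\in\mathcal A$. Let $\sigma=\min_{i\in\mathcal A}s_i$. (If $\mathcal A=\varnothing$, then $\mathcal X=\{x^*\}$ and everything below is trivial.) Corollary. If $X_1$ is initialized sufficiently close to $x^*$, then $\|X_t-x^*\|\to0$ whenever one of the following cases applies, at the following rate: (a) if $\liminf_{z\to0^+}\theta'(z)>-\infty$ (Euclidean-like kernel), there exists $T\ge1$ such that $X_t=x^*$ for all $t\ge T$; (b) if $\liminf_{z\to0^+}[\theta'(z)-\log z]>-\infty$ (entropy-like kernel), then $\|X_t-x^*\|=O(\exp(-\gamma\sigma t/2))$; (c) if $\liminf_{z\to0^+}z^{q}\,\theta'(z)>-\infty$ for some $q\in(0,1)$ (power-like kernel), then $\|X_t-x^*\|=O((\gamma\sigma t/2)^{-1/q})$. -/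

import Mathlib

open Filter Topology Asymptotics Matrix

namespace Bregman

/-- The dual norm `‖y‖_* = sup {⟨y, x⟩ : ‖x‖ ≤ 1}` of a norm `N` on `ℝⁿ`. -/
noncomputable def dualNorm {n : ℕ} (N : Seminorm ℝ (Fin n → ℝ)) (y : Fin n → ℝ) : ℝ :=
  sSup ((fun x => y ⬝ᵥ x) '' {x | N x ≤ 1})

/-- `xs` solves the variational inequality: `⟨v(xs), x - xs⟩ ≥ 0` for all `x ∈ K`. -/
def IsVISolution {n : ℕ} (K : Set (Fin n → ℝ)) (v : (Fin n → ℝ) → (Fin n → ℝ))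
    (xs : Fin n → ℝ) : Prop :=
  xs ∈ K ∧ ∀ x ∈ K, 0 ≤ v xs ⬝ᵥ (x - xs)

/-- `v` is `L`-Lipschitz continuous on `K`, from the norm `N` to its dual norm. -/
def IsLipschitzField {n : ℕ} (N : Seminorm ℝ (Fin n → ℝ)) (K : Set (Fin n → ℝ))
    (v : (Fin n → ℝ) → (Fin n → ℝ)) (L : ℝ) : Prop :=
  ∀ x ∈ K, ∀ x' ∈ K, dualNorm N (v x' - v x) ≤ L * N (x' - x)

/-- Second-order sufficiency at `xs` with modulus `μ`, on some convex neighborhood `B` of `xs`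
in `K`. -/
def SecondOrderSufficient {n : ℕ} (N : Seminorm ℝ (Fin n → ℝ)) (K : Set (Fin n → ℝ))
    (v : (Fin n → ℝ) → (Fin n → ℝ)) (xs : Fin n → ℝ) (μ : ℝ) : Prop :=
  ∃ B : Set (Fin n → ℝ), B ⊆ K ∧ Convex ℝ B ∧ B ∈ 𝓝[K] xs ∧
    ∀ x ∈ B, μ * N (x - xs) ^ 2 ≤ (v x - v xs) ⬝ᵥ (x - xs)

/-! An extended-real-valued convex function `h` with effective domain `K` is represented by its
finite values on `K`; it is understood to be `+∞` off `K`. Values of `h : ℝⁿ → ℝ` off `K` are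
never used. -/

/-- The subdifferential at `x` of the function equal to `h` on `K` and to `+∞` off `K`. -/
def subdiff {n : ℕ} (K : Set (Fin n → ℝ)) (h : (Fin n → ℝ) → ℝ) (x : Fin n → ℝ) :
    Set (Fin n → ℝ) :=
  {g | x ∈ K ∧ ∀ y ∈ K, h x + g ⬝ᵥ (y - x) ≤ h y}

/-- The prox-domain `dom ∂h`. -/
def proxDom {n : ℕ} (K : Set (Fin n → ℝ)) (h : (Fin n → ℝ) → ℝ) : Set (Fin n → ℝ) :=
  {x | (subdiff K h x).Nonempty}

/-- `h` (extended by `+∞` off `K`) is a Bregman regularizer on `K`, and `gradh` is the continuous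
selection of its subdifferential. -/
structure IsRegularizer {n : ℕ} (N : Seminorm ℝ (Fin n → ℝ)) (K : Set (Fin n → ℝ))
    (h : (Fin n → ℝ) → ℝ) (gradh : (Fin n → ℝ) → (Fin n → ℝ)) : Prop where
  proper : K.Nonempty
  lsc : LowerSemicontinuousOn h K
  strictConvex : StrictConvexOn ℝ K h
  selection_mem : ∀ x ∈ proxDom K h, gradh x ∈ subdiff K h x
  selection_cont : ContinuousOn gradh (proxDom K h)
  strongConvex : ∀ x ∈ proxDom K h, ∀ x' ∈ K,
    h x + gradh x ⬝ᵥ (x' - x) + 1 / 2 * N (x' - x) ^ 2 ≤ h x'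

/-- The Bregman divergence `D(p, x) = h(p) - h(x) - ⟨∇h(x), p - x⟩`. -/
noncomputable def breg {n : ℕ} (h : (Fin n → ℝ) → ℝ) (gradh : (Fin n → ℝ) → (Fin n → ℝ))
    (p x : Fin n → ℝ) : ℝ :=
  h p - h x - gradh x ⬝ᵥ (p - x)

/-- `xnew = P_x(y)`, i.e. `xnew` is the (unique) minimizer over `x' ∈ K` of
`⟨y, x - x'⟩ + D(x', x)`. -/
def IsProx {n : ℕ} (K : Set (Fin n → ℝ)) (h : (Fin n → ℝ) → ℝ)
    (gradh : (Fin n → ℝ) → (Fin n → ℝ)) (x y xnew : Fin n → ℝ) : Prop :=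
  xnew ∈ K ∧ IsMinOn (fun x' => y ⬝ᵥ (x - x') + breg h gradh x' x) K xnew

/-- The iterates of the Bregman proximal method with constant step-size `γ` and extrapolation
coefficients `a`, `b`. Here `X t` is the base state `X_t` (`t = 1, 2, …`) and `Y t` is the
leading state `X_{t + 1/2}` (`t = 0, 1, …`), with `X_{1/2} = X_1`; the value `X 0` plays no role.
For all `t ≥ 1`,
`X_{t+1/2} = P_{X_t}(-γ (a v(X_t) + b v(X_{t-1/2})))` and `X_{t+1} = P_{X_t}(-γ v(X_{t+1/2}))`. -/
structure IsBPM {n : ℕ} (K : Set (Fin n → ℝ)) (h : (Fin n → ℝ) → ℝ)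
    (gradh v : (Fin n → ℝ) → (Fin n → ℝ)) (γ a b : ℝ) (X Y : ℕ → (Fin n → ℝ)) : Prop where
  init_mem : X 1 ∈ proxDom K h
  init_lead : Y 0 = X 1
  lead_step : ∀ t, 1 ≤ t →
    IsProx K h gradh (X t) (-(γ • (a • v (X t) + b • v (Y (t - 1))))) (Y t)
  base_step : ∀ t, 1 ≤ t → IsProx K h gradh (X t) (-(γ • v (Y t))) (X (t + 1))

/-- The polyhedron `{x ∈ ℝⁿ₊ : A x = c}`. -/
def polyhedron {m n : ℕ} (A : Matrix (Fin m) (Fin n) ℝ) (c : Fin m → ℝ) : Set (Fin n → ℝ) :=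
  {x | (∀ i, 0 ≤ x i) ∧ A *ᵥ x = c}

/-- The row space of `A`. -/
def rowSpace {m n : ℕ} (A : Matrix (Fin m) (Fin n) ℝ) : Submodule ℝ (Fin n → ℝ) :=
  Submodule.span ℝ (Set.range fun k => A k)

/-- The inequality constraints `x i ≥ 0` that are active at `xs`. -/
def active {n : ℕ} (xs : Fin n → ℝ) : Set (Fin n) := {i | xs i = 0}

open Classical in
/-- `s` is a family of slackness coefficients at `xs`: `s i ≥ 0` for all active `i`, and
`v(xs) - ∑_{i active} s i e_i` lies in the row space of `A`. Only the `s i` with `i` active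
matter. -/
def IsSlackness {m n : ℕ} (A : Matrix (Fin m) (Fin n) ℝ) (v : (Fin n → ℝ) → (Fin n → ℝ))
    (xs s : Fin n → ℝ) : Prop :=
  (∀ i ∈ active xs, 0 ≤ s i) ∧
    v xs - ∑ i with i ∈ active xs, s i • (Pi.single i 1 : Fin n → ℝ) ∈ rowSpace A

/-- The sharp directions at `xs`. -/
def sharpDirs {n : ℕ} (xs s : Fin n → ℝ) : Set (Fin n) := {i | i ∈ active xs ∧ 0 < s i}

/-- The sharpness `min {s i : i sharp}`. (If no constraint is active and `xs` is extreme, the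
polyhedron is the single point `xs`.) -/
noncomputable def sharpness {n : ℕ} (xs s : Fin n → ℝ) : ℝ := sInf (s '' sharpDirs xs s)

/-- The solution `xs` is sharp: it is an extreme point of the polyhedron, and all active directions
are sharp. -/
def IsSharp {m n : ℕ} (A : Matrix (Fin m) (Fin n) ℝ) (c : Fin m → ℝ) (xs s : Fin n → ℝ) : Prop :=
  sharpDirs xs s = active xs ∧ xs ∈ (polyhedron A c).extremePoints ℝ

/-- `θ : ℝ₊ → ℝ` is continuous, twice differentiable on `(0, ∞)` with `θ'' > 0`, and `θ''` is
locally Lipschitz on `(0, ∞)`. -/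
structure IsKernel (θ : ℝ → ℝ) : Prop where
  cont : ContinuousOn θ (Set.Ici 0)
  contDiff : ContDiffOn ℝ 2 θ (Set.Ioi 0)
  deriv2_pos : ∀ z, 0 < z → 0 < deriv (deriv θ) z
  deriv2_lip : LocallyLipschitzOn (Set.Ioi 0) (deriv (deriv θ))

/-- `h` is decomposable on `K` with kernel `θ`. -/
def IsDecomposable {n : ℕ} (K : Set (Fin n → ℝ)) (h : (Fin n → ℝ) → ℝ) (θ : ℝ → ℝ) : Prop :=
  IsKernel θ ∧ ∀ x ∈ K, h x = ∑ i, θ (x i)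

/-- `liminf_{z → 0⁺} θ'(z) > -∞`. -/
def EuclideanLike (θ : ℝ → ℝ) : Prop :=
  (⊥ : EReal) < liminf (fun z : ℝ => ((deriv θ z : ℝ) : EReal)) (𝓝[>] 0)

/-- `liminf_{z → 0⁺} [θ'(z) - log z] > -∞`. -/
def EntropyLike (θ : ℝ → ℝ) : Prop :=
  (⊥ : EReal) < liminf (fun z : ℝ => ((deriv θ z - Real.log z : ℝ) : EReal)) (𝓝[>] 0)

/-- `liminf_{z → 0⁺} z^q θ'(z) > -∞`. -/
def PowerLike (θ : ℝ → ℝ) (q : ℝ) : Prop :=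
  (⊥ : EReal) < liminf (fun z : ℝ => ((z ^ q * deriv θ z : ℝ) : EReal)) (𝓝[>] 0)

end Bregman

/-! Stability comes from an energy. `D(x*, X_t) + N(X_t - X_{t-1/2})² / 6` does not increase as long
as the next leading state lies where the second-order condition holds, and the current energy
already bounds the distance of that state from `x*` (`sq_dist_lead_le_energy`, `energy_descent`).
Since `D(x*, x) → 0` as `x → x*` in the prox-domain (`tendsto_breg`), a close start keeps all states
close.

Let `S(x)` be the sum of the coordinates active at `x*`. Extremality gives `‖x - x*‖ ≤ C S(x)`, and
sharpness gives `⟨v(y), x - x*⟩ ≥ (σ/2) S(x)` for all `y` near `x*`.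

The rate depends on the slope of `θ` at 0. If it is finite, then `x* ∈ dom ∂h`; by continuity `∇h`
varies too little near `x*` to balance the drift `γσ/2`, so one base step lands on `x*`
(`exists_base_step_eq`). If it is `-∞`, base states are positive and `∇h` acts on feasible
directions through the `θ'(x_i)`; the base steps then telescope (`IsBPM.sum_deriv_mul_eq`) to `∑ x_i
θ'(x_i) ≤ (M - γσt/2) S(x)` over active `i`, where `x = X_t`. The lower bound on `θ'` turns this
into decay of `S(X_t)`. -/

namespace Bregman

/-! ### Equivalence of norms and duality. -/

section Norm

variable {n : ℕ} (N : Seminorm ℝ (Fin n → ℝ))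

theorem exists_seminorm_le : ∃ C, 0 < C ∧ ∀ x, N x ≤ C * ‖x‖ := by
  refine ⟨∑ i, N (Pi.single i 1) + 1, ?_, fun x => ?_⟩
  · have : 0 ≤ ∑ i, N (Pi.single i 1) := Finset.sum_nonneg fun i _ => apply_nonneg N _
    linarith
  · have h1 : x = ∑ i, x i • (Pi.single i 1 : Fin n → ℝ) := by
      rw [← pi_eq_sum_univ' x]
    calc N x = N (∑ i, x i • (Pi.single i 1 : Fin n → ℝ)) := by rw [← h1]
      _ ≤ ∑ i, N (x i • (Pi.single i 1 : Fin n → ℝ)) :=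
          Finset.le_sum_of_subadditive N (map_zero N).le (map_add_le_add N) _ _
      _ ≤ ∑ i, N (Pi.single i 1) * ‖x‖ := by
          refine Finset.sum_le_sum fun i _ => ?_
          rw [map_smul_eq_mul, mul_comm]
          exact mul_le_mul_of_nonneg_left (norm_le_pi_norm x i) (apply_nonneg N _)
      _ ≤ (∑ i, N (Pi.single i 1) + 1) * ‖x‖ := by
          rw [← Finset.sum_mul]
          have := norm_nonneg x
          nlinarith

variable {N} in
theorem exists_norm_le (hN : ∀ x, N x = 0 → x = 0) : ∃ C, 0 < C ∧ ∀ x, ‖x‖ ≤ C * N x := by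
  obtain ⟨C₁, hC₁, hle⟩ := exists_seminorm_le N
  have hcont : Continuous N := by
    rw [Metric.continuous_iff]
    intro x ε hε
    refine ⟨ε / C₁, by positivity, fun y hy => ?_⟩
    rw [Real.dist_eq]
    calc |N y - N x| ≤ N (y - x) := abs_sub_map_le_sub N y x
      _ ≤ C₁ * ‖y - x‖ := hle _
      _ < C₁ * (ε / C₁) := by
          rw [dist_eq_norm] at hy
          exact mul_lt_mul_of_pos_left hy hC₁
      _ = ε := by field_simp
  -- The sphere is empty when `n = 0`.
  by_cases hne : (Metric.sphere (0 : Fin n → ℝ) 1).Nonempty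
  · obtain ⟨z, hz, hmin⟩ := (isCompact_sphere (0 : Fin n → ℝ) 1).exists_isMinOn hne
      hcont.continuousOn
    have hz1 : ‖z‖ = 1 := by simpa using hz
    have hNz : 0 < N z := by
      refine lt_of_le_of_ne (apply_nonneg N _) fun h => ?_
      rw [hN z h.symm] at hz1
      simp at hz1
    refine ⟨1 / N z, by positivity, fun x => ?_⟩
    by_cases hx : x = 0
    · simp [hx]
    have hx' : 0 < ‖x‖ := norm_pos_iff.2 hx
    have hmem : (‖x‖⁻¹ • x) ∈ Metric.sphere (0 : Fin n → ℝ) 1 := by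
      simp [norm_smul, hx'.ne']
    have h1 : N z ≤ N (‖x‖⁻¹ • x) := hmin hmem
    rw [map_smul_eq_mul, norm_inv, norm_norm, inv_mul_eq_div, le_div_iff₀ hx'] at h1
    rw [one_div, inv_mul_eq_div, le_div_iff₀ hNz]
    linarith
  · refine ⟨1, one_pos, fun x => ?_⟩
    have hx : x = 0 := by
      by_contra hx
      have hx' : 0 < ‖x‖ := norm_pos_iff.2 hx
      exact hne ⟨‖x‖⁻¹ • x, by simp [norm_smul, hx'.ne']⟩
    simp [hx]

theorem dotProduct_le_sum_mul_norm (y x : Fin n → ℝ) : y ⬝ᵥ x ≤ (∑ i, |y i|) * ‖x‖ := by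
  rw [dotProduct, Finset.sum_mul]
  refine Finset.sum_le_sum fun i _ => ?_
  calc y i * x i ≤ |y i * x i| := le_abs_self _
    _ = |y i| * |x i| := abs_mul _ _
    _ ≤ |y i| * ‖x‖ := mul_le_mul_of_nonneg_left (norm_le_pi_norm x i) (abs_nonneg _)

variable {N} in
theorem dotProduct_le_dualNorm_mul (hN : ∀ x, N x = 0 → x = 0) (y x : Fin n → ℝ) :
    y ⬝ᵥ x ≤ dualNorm N y * N x := by
  obtain ⟨C, hC, hle⟩ := exists_norm_le hN
  by_cases hx : N x = 0
  · simp [hN x hx]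
  have hx' : 0 < N x := lt_of_le_of_ne (apply_nonneg N _) (Ne.symm hx)
  -- An unbounded real `sSup` is 0 by default, so boundedness is needed; it comes from the
  -- equivalence of norms.
  have hbdd : BddAbove ((fun x => y ⬝ᵥ x) '' {x | N x ≤ 1}) := by
    refine ⟨(∑ i, |y i|) * C, ?_⟩
    rintro _ ⟨z, hz, rfl⟩
    refine (dotProduct_le_sum_mul_norm y z).trans
      (mul_le_mul_of_nonneg_left ?_ (Finset.sum_nonneg fun i _ => abs_nonneg _))
    have hz' : N z ≤ 1 := hz
    nlinarith [hle z]
  have h1 : y ⬝ᵥ ((N x)⁻¹ • x) ≤ dualNorm N y := by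
    refine le_csSup hbdd ⟨_, ?_, rfl⟩
    change N ((N x)⁻¹ • x) ≤ 1
    rw [map_smul_eq_mul, norm_inv, Real.norm_of_nonneg hx'.le, inv_mul_cancel₀ hx]
  rw [dotProduct_smul, smul_eq_mul, inv_mul_eq_div, div_le_iff₀ hx'] at h1
  exact h1

variable {N} in
theorem IsLipschitzField.dotProduct_le {K : Set (Fin n → ℝ)} {v : (Fin n → ℝ) → (Fin n → ℝ)}
    {L : ℝ} (hLip : IsLipschitzField N K v L) (hN : ∀ x, N x = 0 → x = 0)
    {x x' : Fin n → ℝ} (hx : x ∈ K) (hx' : x' ∈ K) (d : Fin n → ℝ) :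
    (v x' - v x) ⬝ᵥ d ≤ L * N (x' - x) * N d :=
  (dotProduct_le_dualNorm_mul hN _ _).trans
    (mul_le_mul_of_nonneg_right (hLip x hx x' hx') (apply_nonneg N _))

variable {N} in
/-- Neighbourhoods within a set, measured by `N`. -/
theorem exists_seminorm_ball_of_eventually (hN : ∀ x, N x = 0 → x = 0) {xs : Fin n → ℝ} {S : Set (Fin n → ℝ)}
    {P : (Fin n → ℝ) → Prop} (hP : ∀ᶠ x in 𝓝[S] xs, P x) :
    ∃ δ, 0 < δ ∧ ∀ x ∈ S, N (x - xs) ≤ δ → P x := by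
  obtain ⟨C, hC, hnorm⟩ := exists_norm_le hN
  obtain ⟨ρ, hρ, hball⟩ := Metric.mem_nhdsWithin_iff.1 hP
  refine ⟨ρ / (2 * C), by positivity, fun x hx hle => hball ⟨?_, hx⟩⟩
  rw [Metric.mem_ball, dist_eq_norm]
  calc ‖x - xs‖ ≤ C * N (x - xs) := hnorm _
    _ ≤ C * (ρ / (2 * C)) := by gcongr
    _ = ρ / 2 := by field_simp
    _ < ρ := by linarith

end Norm

/-! ### One-dimensional convexity of the kernel and its behaviour at zero. -/

section Kernel

variable {θ : ℝ → ℝ}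

theorem IsKernel.hasDerivAt (hθ : IsKernel θ) {z : ℝ} (hz : 0 < z) :
    HasDerivAt θ (deriv θ z) z :=
  (((hθ.contDiff.differentiableOn (by norm_num)) z hz).differentiableAt
    (Ioi_mem_nhds hz)).hasDerivAt

theorem IsKernel.continuousOn_deriv (hθ : IsKernel θ) : ContinuousOn (deriv θ) (Set.Ioi 0) :=
  hθ.contDiff.continuousOn_deriv_of_isOpen isOpen_Ioi (by norm_num)

theorem IsKernel.convexOn (hθ : IsKernel θ) : ConvexOn ℝ (Set.Ici 0) θ := by
  refine convexOn_of_deriv2_nonneg (convex_Ici 0) hθ.cont ?_ ?_ ?_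
  · rw [interior_Ici]
    exact hθ.contDiff.differentiableOn (by norm_num)
  · rw [interior_Ici]
    exact ((contDiffOn_succ_iff_deriv_of_isOpen (n := 1) isOpen_Ioi).1
      hθ.contDiff).2.2.differentiableOn (by norm_num)
  · rw [interior_Ici]
    intro x hx
    exact (hθ.deriv2_pos x hx).le

theorem IsKernel.tangent_le (hθ : IsKernel θ) {z w : ℝ} (hz : 0 < z) (hw : 0 ≤ w) :
    θ z + deriv θ z * (w - z) ≤ θ w := by
  rcases lt_trichotomy z w with h | h | h
  · have := hθ.convexOn.le_slope_of_hasDerivAt hz.le hw h (hθ.hasDerivAt hz)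
    rw [slope_def_field, le_div_iff₀ (by linarith)] at this
    linarith
  · simp [h]
  · have := hθ.convexOn.slope_le_of_hasDerivAt hw hz.le h (hθ.hasDerivAt hz)
    rw [slope_def_field, div_le_iff₀ (by linarith)] at this
    linarith

theorem IsKernel.deriv_mono (hθ : IsKernel θ) {z w : ℝ} (hz : 0 < z) (hzw : z ≤ w) :
    deriv θ z ≤ deriv θ w := by
  rcases hzw.eq_or_lt with rfl | h
  · rfl
  have h1 := hθ.tangent_le hz (hz.le.trans hzw)
  have h2 := hθ.tangent_le (hz.trans h) hz.le
  have h3 : 0 ≤ (deriv θ w - deriv θ z) * (w - z) := by linarith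
  by_contra hlt
  nlinarith

/-- Every slope of `θ` from `0` is bounded from below by a common constant. -/
def SlopeBounded (θ : ℝ → ℝ) : Prop := ∃ C, ∀ z, 0 ≤ z → θ 0 - C * z ≤ θ z

theorem exists_lt_eventually_of_bot_lt_liminf {f : ℝ → ℝ} {l : Filter ℝ}
    (hf : (⊥ : EReal) < liminf (fun z => ((f z : ℝ) : EReal)) l) : ∃ C : ℝ, ∀ᶠ z in l, C < f z := by
  obtain ⟨q, hq, hlt⟩ := EReal.lt_iff_exists_real_btwn.1 hf
  refine ⟨q, (eventually_lt_of_lt_liminf hlt).mono fun z hz => ?_⟩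
  exact_mod_cast hz

theorem exists_Ioo_of_bot_lt_liminf {f : ℝ → ℝ}
    (hf : (⊥ : EReal) < liminf (fun z => ((f z : ℝ) : EReal)) (𝓝[>] 0)) :
    ∃ C z₀ : ℝ, 0 < z₀ ∧ ∀ z, 0 < z → z < z₀ → C < f z := by
  obtain ⟨C, hC⟩ := exists_lt_eventually_of_bot_lt_liminf hf
  obtain ⟨z₀, hz₀, hsub⟩ := mem_nhdsGT_iff_exists_Ioo_subset.1 hC
  exact ⟨C, z₀, hz₀, fun z h1 h2 => hsub ⟨h1, h2⟩⟩

theorem EuclideanLike.slopeBounded (hE : EuclideanLike θ) (hθ : IsKernel θ) : SlopeBounded θ := by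
  obtain ⟨C, z₀, hz₀, hC⟩ := exists_Ioo_of_bot_lt_liminf hE
  -- Monotonicity of `θ'` makes the bound near 0 global.
  have hlow : ∀ z, 0 < z → C ≤ deriv θ z := fun z hz =>
    (hC (min z (z₀ / 2)) (lt_min hz (by linarith))
      ((min_le_right _ _).trans_lt (by linarith))).le.trans
      (hθ.deriv_mono (lt_min hz (by linarith)) (min_le_left _ _))
  have hmono : MonotoneOn (fun z => θ z - C * z) (Set.Ici 0) := by
    refine monotoneOn_of_deriv_nonneg (convex_Ici 0)
      (hθ.cont.sub (by fun_prop)) ?_ ?_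
    · rw [interior_Ici]
      intro z hz
      exact ((hθ.hasDerivAt hz).differentiableAt.sub (by fun_prop)).differentiableWithinAt
    · rw [interior_Ici]
      intro z hz
      have := ((hθ.hasDerivAt hz).sub ((hasDerivAt_id z).const_mul C)).deriv
      have h2 : deriv (fun z => θ z - C * z) z = deriv θ z - C * 1 := this
      rw [h2]
      linarith [hlow z hz]
  refine ⟨-C, fun z hz => ?_⟩
  have := hmono (Set.self_mem_Ici) (Set.mem_Ici.2 hz) hz
  simp only at this
  linarith

/-- The liminf controls `θ'` only near 0; monotonicity of `θ'` and `log z ≤ 0` extend the bound to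
`(0, 1]`. -/
theorem EntropyLike.exists_le_deriv (hE : EntropyLike θ) (hθ : IsKernel θ) :
    ∃ C, ∀ z, 0 < z → z ≤ 1 → Real.log z - C ≤ deriv θ z := by
  obtain ⟨C, z₀, hz₀, hC⟩ := exists_Ioo_of_bot_lt_liminf hE
  refine ⟨max (-C) (-deriv θ z₀), fun z hz hz1 => ?_⟩
  rcases lt_or_ge z z₀ with h | h
  · linarith [hC z hz h, le_max_left (-C) (-deriv θ z₀)]
  · linarith [hθ.deriv_mono hz₀ h, Real.log_nonpos hz.le hz1, le_max_right (-C) (-deriv θ z₀)]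

theorem PowerLike.exists_le_deriv {q : ℝ} (hq : 0 < q) (hP : PowerLike θ q) (hθ : IsKernel θ) :
    ∃ C, 0 < C ∧ ∀ z, 0 < z → z ≤ 1 → -C * z ^ (-q) ≤ deriv θ z := by
  obtain ⟨C, z₀, hz₀, hC⟩ := exists_Ioo_of_bot_lt_liminf hP
  refine ⟨|C| + |deriv θ z₀| + 1, by positivity, fun z hz hz1 => ?_⟩
  have hzq : 0 < z ^ q := Real.rpow_pos_of_pos hz q
  rw [Real.rpow_neg hz.le, ← div_eq_mul_inv, div_le_iff₀ hzq]
  rcases lt_or_ge z z₀ with h | h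
  · linarith [hC z hz h, neg_abs_le C, abs_nonneg (deriv θ z₀)]
  · have h1 := hθ.deriv_mono hz₀ h
    have h2 : z ^ q ≤ 1 := Real.rpow_le_one hz.le hz1 hq.le
    have h3 := neg_abs_le (deriv θ z₀)
    have h4 : -|deriv θ z₀| * z ^ q ≤ deriv θ z * z ^ q :=
      mul_le_mul_of_nonneg_right (h3.trans h1) hzq.le
    nlinarith [abs_nonneg C, abs_nonneg (deriv θ z₀)]

/-- Even if `θ'` blows up at 0, the tangent at `z` gives `θ z - θ 0 ≤ z θ'(z)`, and monotonicity
gives `z θ'(z) ≤ z θ'(1)` for `z < 1`. This makes the divergence vanish at boundary coordinates. -/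
theorem IsKernel.tendsto_mul_deriv (hθ : IsKernel θ) :
    Tendsto (fun z => deriv θ z * z) (𝓝[>] 0) (𝓝 0) := by
  have h0 : Tendsto θ (𝓝[>] 0) (𝓝 (θ 0)) :=
    (hθ.cont 0 Set.self_mem_Ici).mono_left (nhdsWithin_mono _ Set.Ioi_subset_Ici_self)
  have h1 : Tendsto (fun z => θ z - θ 0) (𝓝[>] 0) (𝓝 0) := by
    simpa using h0.sub_const (θ 0)
  have h2 : Tendsto (fun z => deriv θ 1 * z) (𝓝[>] 0) (𝓝 0) := by
    have : Tendsto (fun z : ℝ => deriv θ 1 * z) (𝓝 0) (𝓝 (deriv θ 1 * 0)) :=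
      (continuous_const.mul continuous_id).tendsto 0
    rw [mul_zero] at this
    exact this.mono_left nhdsWithin_le_nhds
  refine tendsto_of_tendsto_of_tendsto_of_le_of_le' h1 h2 ?_ ?_
  · filter_upwards [self_mem_nhdsWithin] with z hz
    have := hθ.tangent_le (Set.mem_Ioi.1 hz) le_rfl
    linarith
  · filter_upwards [Ioo_mem_nhdsGT (zero_lt_one' ℝ)] with z hz
    exact mul_le_mul_of_nonneg_right (hθ.deriv_mono hz.1 hz.2.le) hz.1.le

end Kernel

/-! ### Prox steps and the role of the selected subgradient. -/

section ProxStep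

variable {n : ℕ} {K : Set (Fin n → ℝ)} {h : (Fin n → ℝ) → ℝ}
  {gradh : (Fin n → ℝ) → (Fin n → ℝ)} {N : Seminorm ℝ (Fin n → ℝ)}

theorem IsProx.mem_subdiff {x y xn : Fin n → ℝ} (hp : IsProx K h gradh x y xn) :
    gradh x + y ∈ subdiff K h xn := by
  refine ⟨hp.1, fun p hpK => ?_⟩
  have h1 : y ⬝ᵥ (x - xn) + breg h gradh xn x ≤ y ⬝ᵥ (x - p) + breg h gradh p x := hp.2 hpK
  simp only [breg, dotProduct_sub, add_dotProduct] at h1 ⊢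
  linarith

theorem IsProx.mem_proxDom {x y xn : Fin n → ℝ} (hp : IsProx K h gradh x y xn) :
    xn ∈ proxDom K h := ⟨_, hp.mem_subdiff⟩

theorem mem_of_mem_proxDom {x : Fin n → ℝ} (hx : x ∈ proxDom K h) : x ∈ K := by
  obtain ⟨g, hg⟩ := hx
  exact hg.1

/-- `gradh` is the subgradient with the largest directional derivatives into `K`. -/
def IsMaximalSelection (K : Set (Fin n → ℝ)) (h : (Fin n → ℝ) → ℝ)
    (gradh : (Fin n → ℝ) → (Fin n → ℝ)) : Prop :=
  ∀ x, ∀ g ∈ subdiff K h x, ∀ p ∈ K, g ⬝ᵥ (p - x) ≤ gradh x ⬝ᵥ (p - x)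

/-- Minimality only makes `gradh x + y` some subgradient at `xn`; maximality is what allows a
comparison with `gradh xn` itself. -/
theorem IsProx.optimality (hsel : IsMaximalSelection K h gradh) {x y xn p : Fin n → ℝ}
    (hp : IsProx K h gradh x y xn) (hpK : p ∈ K) :
    (gradh x + y) ⬝ᵥ (p - xn) ≤ gradh xn ⬝ᵥ (p - xn) :=
  hsel xn _ hp.mem_subdiff p hpK

theorem IsProx.breg_le (hsel : IsMaximalSelection K h gradh) {x y xn p : Fin n → ℝ}
    (hp : IsProx K h gradh x y xn) (hpK : p ∈ K) :
    breg h gradh p xn + breg h gradh xn x ≤ breg h gradh p x + y ⬝ᵥ (xn - p) := by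
  have h1 := hp.optimality hsel hpK
  simp only [breg, dotProduct_sub, add_dotProduct] at h1 ⊢
  linarith

theorem IsRegularizer.half_sq_le_breg (hreg : IsRegularizer N K h gradh) {x p : Fin n → ℝ}
    (hx : x ∈ proxDom K h) (hp : p ∈ K) : 1 / 2 * N (p - x) ^ 2 ≤ breg h gradh p x := by
  have := hreg.strongConvex x hx p hp
  rw [breg]
  linarith

/-- Monotonicity of the subdifferential between `x` and `x + t(p - x)`, divided by `t`, compares `g`
with `gradh` at the moved point; as `t → 0⁺`, continuity of the selection brings that point back to
`x`. -/
theorem IsMaximalSelection.of_segment (hreg : IsRegularizer N K h gradh)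
    (hseg : ∀ x ∈ proxDom K h, ∀ p ∈ K, ∀ t : ℝ, 0 ≤ t → t < 1 → x + t • (p - x) ∈ proxDom K h) :
    IsMaximalSelection K h gradh := by
  intro x g hg p hp
  have hx : x ∈ proxDom K h := ⟨g, hg⟩
  have hcont : Tendsto (fun t : ℝ => gradh (x + t • (p - x)) ⬝ᵥ (p - x)) (𝓝[>] 0)
      (𝓝 (gradh x ⬝ᵥ (p - x))) := by
    have h1 : Tendsto (fun t : ℝ => x + t • (p - x)) (𝓝[>] 0) (𝓝[proxDom K h] x) := by
      refine tendsto_nhdsWithin_iff.2 ⟨?_, ?_⟩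
      · have : Continuous fun t : ℝ => x + t • (p - x) := by fun_prop
        have h2 := this.tendsto 0
        simp only [zero_smul, add_zero] at h2
        exact h2.mono_left nhdsWithin_le_nhds
      · filter_upwards [Ioo_mem_nhdsGT (zero_lt_one' ℝ)] with t ht
        exact hseg x hx p hp t ht.1.le ht.2
    have h2 : Tendsto (fun t : ℝ => gradh (x + t • (p - x))) (𝓝[>] 0) (𝓝 (gradh x)) :=
      (hreg.selection_cont x hx).tendsto.comp h1
    have h3 : Continuous fun z : Fin n → ℝ => z ⬝ᵥ (p - x) := by fun_prop
    exact (h3.tendsto _).comp h2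
  refine ge_of_tendsto hcont ?_
  filter_upwards [Ioo_mem_nhdsGT (zero_lt_one' ℝ)] with t ht
  have hz := hseg x hx p hp t ht.1.le ht.2
  have h1 := hg.2 _ (mem_of_mem_proxDom hz)
  have h2 := (hreg.selection_mem _ hz).2 x hg.1
  have e1 : x + t • (p - x) - x = t • (p - x) := by abel
  have e2 : x - (x + t • (p - x)) = -(t • (p - x)) := by abel
  rw [e1, dotProduct_smul, smul_eq_mul] at h1
  rw [e2, dotProduct_neg, dotProduct_smul, smul_eq_mul] at h2
  have h3 : t * (g ⬝ᵥ (p - x)) ≤ t * (gradh (x + t • (p - x)) ⬝ᵥ (p - x)) := by linarith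
  exact le_of_mul_le_mul_left h3 ht.1

end ProxStep

/-! ### Lyapunov energy and stability. -/

section Energy

variable {n : ℕ} {K : Set (Fin n → ℝ)} {h : (Fin n → ℝ) → ℝ}
  {gradh v : (Fin n → ℝ) → (Fin n → ℝ)} {N : Seminorm ℝ (Fin n → ℝ)} {xs : Fin n → ℝ}
  {L μ γ a b : ℝ}

/-- The energy of the method at base state `x` with previous leading state `y`. -/
noncomputable def energy (N : Seminorm ℝ (Fin n → ℝ)) (h : (Fin n → ℝ) → ℝ)
    (gradh : (Fin n → ℝ) → (Fin n → ℝ)) (xs x y : Fin n → ℝ) : ℝ :=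
  breg h gradh xs x + N (x - y) ^ 2 / 6

theorem sq_dist_base_le_energy (hreg : IsRegularizer N K h gradh) (hxs : xs ∈ K)
    {x y : Fin n → ℝ} (hx : x ∈ proxDom K h) :
    N (x - xs) ^ 2 ≤ 2 * energy N h gradh xs x y := by
  have h1 := hreg.half_sq_le_breg hx hxs
  rw [map_sub_rev N] at h1
  have := sq_nonneg (N (x - y))
  rw [energy]
  linarith

/-- The bound does not require `y'` to lie in the second-order neighbourhood, which is why it can be
used to place `y'` there. The factor 10 is not optimal. -/
theorem sq_dist_lead_le_energy (hN : ∀ x, N x = 0 → x = 0)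
    (hLip : IsLipschitzField N K v L) (hsol : IsVISolution K v xs)
    (hreg : IsRegularizer N K h gradh) (hsel : IsMaximalSelection K h gradh)
    (ha : 0 ≤ a) (hb : 0 ≤ b) (hab : a + b ≤ 1) (hL : 0 < L) (hγ : 0 < γ) (hγL : γ * L ≤ 1 / 3)
    {x y y' : Fin n → ℝ} (hx : x ∈ proxDom K h) (hy : y ∈ K)
    (hp : IsProx K h gradh x (-(γ • (a • v x + b • v y))) y') :
    N (y' - xs) ^ 2 ≤ 10 * energy N h gradh xs x y := by
  have hxK := mem_of_mem_proxDom hx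
  have h1 := hp.breg_le hsel hsol.1
  have h2 := hreg.half_sq_le_breg hp.mem_proxDom hsol.1
  have h3 := hreg.half_sq_le_breg hx hp.1
  have h4 := hreg.half_sq_le_breg hx hsol.1
  have h5 := hLip.dotProduct_le hN hxK hsol.1 (y' - xs)
  have h6 := hLip.dotProduct_le hN hy hsol.1 (y' - xs)
  have h7 := hsol.2 y' hp.1
  rw [map_sub_rev N xs] at h2 h4 h5 h6
  have e1 : -(γ • (a • v x + b • v y)) ⬝ᵥ (y' - xs) =
      γ * (a * ((v xs - v x) ⬝ᵥ (y' - xs)) + b * ((v xs - v y) ⬝ᵥ (y' - xs)))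
        - γ * ((a + b) * (v xs ⬝ᵥ (y' - xs))) := by
    simp only [neg_dotProduct, smul_dotProduct, add_dotProduct, sub_dotProduct, smul_eq_mul]
    ring
  rw [e1] at h1
  have h8 : N (y - xs) ≤ N (x - xs) + N (x - y) := by
    have := map_add_le_add N (x - xs) (y - x)
    rw [map_sub_rev N x y]
    simpa [add_comm] using this
  set ρ := N (y' - xs) with hρ
  set w := N (x - xs) with hw
  set e := N (x - y) with he
  have hρ0 : 0 ≤ ρ := apply_nonneg N _
  have hw0 : 0 ≤ w := apply_nonneg N _
  have he0 : 0 ≤ e := apply_nonneg N _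
  have h9 : 0 ≤ γ * ((a + b) * (v xs ⬝ᵥ (y' - xs))) := by positivity
  have h10 : a * ((v xs - v x) ⬝ᵥ (y' - xs)) + b * ((v xs - v y) ⬝ᵥ (y' - xs))
      ≤ L * ((w + e) * ρ) := by
    have i1 : (v xs - v x) ⬝ᵥ (y' - xs) ≤ L * ((w + e) * ρ) := by
      refine h5.trans ?_
      rw [mul_assoc]
      gcongr
      linarith
    have i2 : (v xs - v y) ⬝ᵥ (y' - xs) ≤ L * ((w + e) * ρ) := by
      refine h6.trans ?_
      rw [mul_assoc]
      gcongr
    have i3 := mul_le_mul_of_nonneg_left i1 ha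
    have i4 := mul_le_mul_of_nonneg_left i2 hb
    have i5 : 0 ≤ L * ((w + e) * ρ) := by positivity
    have i6 := mul_le_mul_of_nonneg_right hab i5
    linarith
  have h11 : γ * (a * ((v xs - v x) ⬝ᵥ (y' - xs)) + b * ((v xs - v y) ⬝ᵥ (y' - xs)))
      ≤ 1 / 3 * ((w + e) * ρ) := by
    calc _ ≤ γ * (L * ((w + e) * ρ)) := mul_le_mul_of_nonneg_left h10 hγ.le
      _ = γ * L * ((w + e) * ρ) := by ring
      _ ≤ _ := mul_le_mul_of_nonneg_right hγL (by positivity)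
  have h12 : 0 ≤ N (y' - x) ^ 2 := sq_nonneg _
  rw [energy]
  nlinarith [sq_nonneg (ρ - 2 / 3 * (w + e)), sq_nonneg (w - e)]

theorem energy_descent (hN : ∀ x, N x = 0 → x = 0)
    (hLip : IsLipschitzField N K v L) (hsol : IsVISolution K v xs)
    (hreg : IsRegularizer N K h gradh) (hsel : IsMaximalSelection K h gradh)
    (ha : 0 ≤ a) (hb : 0 ≤ b) (hab : a + b ≤ 1) (hL : 0 < L) (hγ : 0 < γ) (hγL : γ * L ≤ 1 / 3)
    (hγμ : γ * (1 - a - b) ^ 2 ≤ μ / (8 * L ^ 2))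
    {x x' y y' : Fin n → ℝ} (hx : x ∈ proxDom K h) (hy : y ∈ K)
    (hp : IsProx K h gradh x (-(γ • (a • v x + b • v y))) y')
    (hp' : IsProx K h gradh x (-(γ • v y')) x')
    (hmono : μ * N (y' - xs) ^ 2 ≤ (v y' - v xs) ⬝ᵥ (y' - xs)) :
    energy N h gradh xs x' y' ≤ energy N h gradh xs x y := by
  have hxK := mem_of_mem_proxDom hx
  have h1 := hp'.breg_le hsel hsol.1
  have h2 := hp.breg_le hsel hp'.1
  have h3 := hreg.half_sq_le_breg hp.mem_proxDom hp'.1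
  have h4 := hreg.half_sq_le_breg hx hp.1
  have h5 := hLip.dotProduct_le hN hp.1 hxK (x' - y')
  have h6 := hLip.dotProduct_le hN hp.1 hy (x' - y')
  have h7 := hLip.dotProduct_le hN hp.1 hsol.1 (x' - y')
  have h8 := hsol.2 y' hp.1
  have h9 := hsol.2 x' hp'.1
  rw [map_sub_rev N x] at h5
  rw [map_sub_rev N xs] at h7
  -- The extrapolated field falls short of a full `v` by the weight `1 - a - b`; this weight is
  -- filled with `v xs`, whose error is later absorbed by `μ`.
  have e1 : -(γ • v y') ⬝ᵥ (x' - xs) + -(γ • (a • v x + b • v y)) ⬝ᵥ (y' - x') =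
      γ * (a * ((v x - v y') ⬝ᵥ (x' - y')) + b * ((v y - v y') ⬝ᵥ (x' - y')) +
        (1 - a - b) * ((v xs - v y') ⬝ᵥ (x' - y')))
      - γ * ((v y' - v xs) ⬝ᵥ (y' - xs))
      - γ * ((a + b) * (v xs ⬝ᵥ (y' - xs)) + (1 - a - b) * (v xs ⬝ᵥ (x' - xs))) := by
    simp only [neg_dotProduct, smul_dotProduct, add_dotProduct, sub_dotProduct, smul_eq_mul,
      dotProduct_sub]
    ring
  have hη : 0 ≤ 1 - a - b := by linarith
  have h10 : N (y - y') ≤ N (y' - x) + N (x - y) := by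
    have := map_add_le_add N (y' - x) (x - y)
    rw [map_sub_rev N y y']
    simpa using this
  set ρ := N (y' - xs) with hρ
  set r := N (y' - x) with hr
  set e := N (x - y) with he
  set e' := N (x' - y') with he'
  set η := 1 - a - b with hηdef
  have hρ0 : 0 ≤ ρ := apply_nonneg N _
  have hr0 : 0 ≤ r := apply_nonneg N _
  have he0 : 0 ≤ e := apply_nonneg N _
  have he'0 : 0 ≤ e' := apply_nonneg N _
  have h11 : 0 ≤ γ * ((a + b) * (v xs ⬝ᵥ (y' - xs)) + η * (v xs ⬝ᵥ (x' - xs))) := by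
    positivity
  have h12 : a * ((v x - v y') ⬝ᵥ (x' - y')) + b * ((v y - v y') ⬝ᵥ (x' - y'))
      ≤ L * ((r + e) * e') := by
    have i1 : (v x - v y') ⬝ᵥ (x' - y') ≤ L * ((r + e) * e') := by
      refine h5.trans ?_
      rw [mul_assoc]
      gcongr
      linarith
    have i2 : (v y - v y') ⬝ᵥ (x' - y') ≤ L * ((r + e) * e') := by
      refine h6.trans ?_
      rw [mul_assoc]
      gcongr
    have i3 := mul_le_mul_of_nonneg_left i1 ha
    have i4 := mul_le_mul_of_nonneg_left i2 hb
    have i5 : 0 ≤ L * ((r + e) * e') := by positivity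
    have i6 := mul_le_mul_of_nonneg_right hab i5
    linarith
  have h13 : γ * (a * ((v x - v y') ⬝ᵥ (x' - y')) + b * ((v y - v y') ⬝ᵥ (x' - y')))
      ≤ 1 / 3 * ((r + e) * e') := by
    calc _ ≤ γ * (L * ((r + e) * e')) := mul_le_mul_of_nonneg_left h12 hγ.le
      _ = γ * L * ((r + e) * e') := by ring
      _ ≤ _ := mul_le_mul_of_nonneg_right hγL (by positivity)
  have h14 : γ * (η * ((v xs - v y') ⬝ᵥ (x' - y'))) ≤ (γ * L * η * ρ) * e' := by
    calc _ = γ * η * ((v xs - v y') ⬝ᵥ (x' - y')) := by ring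
      _ ≤ γ * η * (L * ρ * e') := mul_le_mul_of_nonneg_left h7 (mul_nonneg hγ.le hη)
      _ = _ := by ring
  have h15 : (γ * L * η * ρ) ^ 2 ≤ γ * μ / 8 * ρ ^ 2 := by
    rw [le_div_iff₀ (by positivity)] at hγμ
    have : γ * (γ * η ^ 2 * (8 * L ^ 2)) * ρ ^ 2 ≤ γ * μ * ρ ^ 2 := by gcongr
    calc _ = γ * (γ * η ^ 2 * (8 * L ^ 2)) * ρ ^ 2 / 8 := by ring
      _ ≤ γ * μ * ρ ^ 2 / 8 := by linarith
      _ = _ := by ring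
  have h16 : γ * (μ * ρ ^ 2) ≤ γ * ((v y' - v xs) ⬝ᵥ (y' - xs)) :=
    mul_le_mul_of_nonneg_left hmono hγ.le
  have h17 : (γ * L * η * ρ) * e' ≤ 4 * (γ * L * η * ρ) ^ 2 + e' ^ 2 / 16 := by
    generalize γ * L * η * ρ = z
    linarith [sq_nonneg (2 * z - e' / 4)]
  have h18 : 0 ≤ γ * (μ * ρ ^ 2) := by
    have : 0 ≤ (γ * L * η * ρ) ^ 2 := sq_nonneg _
    linarith
  -- The `r²/2` is paid by `D(y', x)`, the `e²/6` by the old energy. Of the `e'²/2` in `D(x', y')`,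
  -- the errors take `2/9 + 1/16`, leaving more than the `1/6` in the new energy.
  have h19 : 1 / 3 * ((r + e) * e') ≤ r ^ 2 / 2 + e ^ 2 / 6 + (1 / 18 + 1 / 6) * e' ^ 2 := by
    linarith [sq_nonneg (r - e' / 3), sq_nonneg (e - e')]
  rw [energy, energy, ← he, ← he']
  linarith [sq_nonneg e']

theorem exists_energy_stability (hN : ∀ x, N x = 0 → x = 0)
    (hLip : IsLipschitzField N K v L) (hsol : IsVISolution K v xs)
    (hSOS : SecondOrderSufficient N K v xs μ)
    (hreg : IsRegularizer N K h gradh) (hsel : IsMaximalSelection K h gradh)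
    (ha : 0 ≤ a) (hb : 0 ≤ b) (hab : a + b ≤ 1) (hL : 0 < L) (hγ : 0 < γ) (hγL : γ * L ≤ 1 / 3)
    (hγμ : γ * (1 - a - b) ^ 2 ≤ μ / (8 * L ^ 2)) {r : ℝ} (hr : 0 < r) :
    ∃ ε, 0 < ε ∧ ∀ X Y : ℕ → (Fin n → ℝ), IsBPM K h gradh v γ a b X Y →
      breg h gradh xs (X 1) ≤ ε → ∀ t, 1 ≤ t → N (X t - xs) ≤ r ∧ N (Y t - xs) ≤ r := by
  obtain ⟨B, hBK, -, hBnhds, hBmono⟩ := hSOS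
  obtain ⟨ρ, hρ, hball⟩ := exists_seminorm_ball_of_eventually hN hBnhds
  set R := min r ρ with hR
  have hR0 : 0 < R := lt_min hr hρ
  have hB : ∀ y ∈ K, N (y - xs) ≤ R → y ∈ B := fun y hy hle =>
    hball y hy (hle.trans (min_le_right _ _))
  -- Matches the factor 10 in `sq_dist_lead_le_energy`: energy at most `R²/10` puts the next leading
  -- state within `R`, inside `B`, so descent applies.
  refine ⟨R ^ 2 / 10, by positivity, fun X Y hXY hinit => ?_⟩
  have hlead : ∀ t, 1 ≤ t → X t ∈ proxDom K h → Y (t - 1) ∈ K →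
      energy N h gradh xs (X t) (Y (t - 1)) ≤ R ^ 2 / 10 → N (Y t - xs) ≤ R := by
    intro t ht hX hY hE
    have := sq_dist_lead_le_energy hN hLip hsol hreg hsel ha hb hab hL hγ hγL hX hY
      (hXY.lead_step t ht)
    exact le_of_sq_le_sq (by linarith) hR0.le
  have key : ∀ t, 1 ≤ t → X t ∈ proxDom K h ∧ Y (t - 1) ∈ K ∧
      energy N h gradh xs (X t) (Y (t - 1)) ≤ R ^ 2 / 10 := by
    intro t ht
    induction t, ht using Nat.le_induction with
    | base =>
      refine ⟨hXY.init_mem, ?_, ?_⟩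
      · rw [Nat.sub_self, hXY.init_lead]
        exact mem_of_mem_proxDom hXY.init_mem
      · rw [Nat.sub_self, hXY.init_lead, energy, sub_self, map_zero]
        linarith
    | succ t ht ih =>
      obtain ⟨hX, hY, hE⟩ := ih
      have hYt := hlead t ht hX hY hE
      refine ⟨(hXY.base_step t ht).mem_proxDom, ?_, ?_⟩
      · rw [Nat.add_sub_cancel]
        exact (hXY.lead_step t ht).1
      · rw [Nat.add_sub_cancel]
        exact (energy_descent hN hLip hsol hreg hsel ha hb hab hL hγ hγL hγμ hX hY
          (hXY.lead_step t ht) (hXY.base_step t ht)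
          (hBmono _ (hB _ (hXY.lead_step t ht).1 hYt))).trans hE
  intro t ht
  obtain ⟨hX, hY, hE⟩ := key t ht
  refine ⟨?_, (hlead t ht hX hY hE).trans (min_le_left _ _)⟩
  have h1 := sq_dist_base_le_energy hreg hsol.1 (y := Y (t - 1)) hX
  have h2 : N (X t - xs) ≤ R := by
    refine le_of_sq_le_sq ?_ hR0.le
    nlinarith
  exact h2.trans (min_le_left _ _)

end Energy

/-! ### Geometry of the polyhedron at a sharp extreme point. -/

section Polyhedron

variable {m n : ℕ} {A : Matrix (Fin m) (Fin n) ℝ} {c : Fin m → ℝ} {xs s : Fin n → ℝ}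

theorem mulVec_sub_eq_zero {x y : Fin n → ℝ} (hx : x ∈ polyhedron A c) (hy : y ∈ polyhedron A c) :
    A *ᵥ (x - y) = 0 := by
  rw [mulVec_sub, hx.2, hy.2, sub_self]

theorem add_smul_sub_mem_polyhedron {x y : Fin n → ℝ} (hx : x ∈ polyhedron A c)
    (hy : y ∈ polyhedron A c) {t : ℝ} (ht : 0 ≤ t) (ht1 : t ≤ 1) :
    x + t • (y - x) ∈ polyhedron A c := by
  refine ⟨fun i => ?_, ?_⟩
  · have h1 := hx.1 i
    have h2 := hy.1 i
    simp only [Pi.add_apply, Pi.smul_apply, Pi.sub_apply, smul_eq_mul]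
    nlinarith
  · rw [mulVec_add, mulVec_smul, mulVec_sub_eq_zero hy hx, hx.2, smul_zero, add_zero]

/-- The sum of the coordinates of `x` whose constraint is active at `xs`. -/
noncomputable def activeSum (xs x : Fin n → ℝ) : ℝ := ∑ i with xs i = 0, x i

theorem activeSum_nonneg {x : Fin n → ℝ} (hx : x ∈ polyhedron A c) : 0 ≤ activeSum xs x :=
  Finset.sum_nonneg fun i _ => hx.1 i

theorem exists_pos_le_one_and_le_half (hxs : ∀ i, 0 ≤ xs i) :
    ∃ ρ : ℝ, 0 < ρ ∧ ρ ≤ 1 ∧ ∀ i, xs i ≠ 0 → ρ ≤ xs i / 2 := by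
  have h : ∀ᶠ ρ : ℝ in 𝓝[>] 0, ∀ i, xs i ≠ 0 → ρ ≤ xs i / 2 := by
    refine eventually_all.2 fun i => ?_
    by_cases hi : xs i = 0
    · exact Eventually.of_forall fun ρ hne => absurd hi hne
    · have hpos : 0 < xs i / 2 := by
        have := lt_of_le_of_ne (hxs i) (Ne.symm hi)
        linarith
      filter_upwards [Ioo_mem_nhdsGT hpos] with ρ hρ _ using hρ.2.le
  obtain ⟨ρ, h1, h2⟩ := (h.and (Ioo_mem_nhdsGT (zero_lt_one' ℝ))).exists
  exact ⟨ρ, h2.1, h2.2.le, h1⟩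

/-- Such a direction can be followed a little both ways inside the polyhedron, so a nonzero one
would contradict extremality. -/
theorem eq_zero_of_mem_extremePoints (hext : xs ∈ (polyhedron A c).extremePoints ℝ)
    {d : Fin n → ℝ} (hd : A *ᵥ d = 0) (hact : ∀ i, xs i = 0 → d i = 0) : d = 0 := by
  have hxs : xs ∈ polyhedron A c := hext.1
  obtain ⟨ρ, hρ, -, hρle⟩ := exists_pos_le_one_and_le_half hxs.1
  -- Inactive coordinates move by at most `ρ`; the `+ 1` avoids division by zero.
  set t := ρ / (‖d‖ + 1) with ht
  have hn := norm_nonneg d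
  have ht0 : 0 < t := by positivity
  have hsmall : ∀ i, |t * d i| ≤ xs i := by
    intro i
    by_cases hi : xs i = 0
    · simp [hact i hi, hi]
    · have h1 := hρle i hi
      have h2 := hxs.1 i
      rw [abs_mul, abs_of_pos ht0, ht, div_mul_eq_mul_div, div_le_iff₀ (by positivity)]
      have h3 : |d i| ≤ ‖d‖ := norm_le_pi_norm d i
      nlinarith
  have hmem : ∀ e : ℝ, |e| = 1 → xs + (e * t) • d ∈ polyhedron A c := by
    intro e he
    refine ⟨fun i => ?_, ?_⟩
    · have h1 : |e * t * d i| ≤ xs i := by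
        rw [mul_assoc, abs_mul, he, one_mul]
        exact hsmall i
      have h2 := neg_abs_le (e * t * d i)
      simp only [Pi.add_apply, Pi.smul_apply, smul_eq_mul]
      linarith
    · rw [mulVec_add, mulVec_smul, hd, hxs.2, smul_zero, add_zero]
  have hseg : xs ∈ openSegment ℝ (xs + ((1 : ℝ) * t) • d) (xs + ((-1 : ℝ) * t) • d) := by
    refine ⟨1 / 2, 1 / 2, by norm_num, by norm_num, by norm_num, ?_⟩
    ext i
    simp only [Pi.add_apply, Pi.smul_apply, smul_eq_mul]
    ring
  have h1 : xs + ((1 : ℝ) * t) • d = xs :=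
    hext.2 (hmem 1 (by norm_num)) (hmem (-1) (by norm_num)) hseg
  have h2 : ((1 : ℝ) * t) • d = 0 := by simpa using h1
  rw [one_mul] at h2
  exact (smul_eq_zero.1 h2).resolve_left ht0.ne'

/-- By extremality the linear map sending `d` to `A d` and its active coordinates is injective,
hence bounded below in finite dimension. On `x - xs` only the active coordinates survive, and they
are nonnegative. -/
theorem exists_norm_sub_le_activeSum (hext : xs ∈ (polyhedron A c).extremePoints ℝ) :
    ∃ C, 0 < C ∧ ∀ x ∈ polyhedron A c, ‖x - xs‖ ≤ C * activeSum xs x := by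
  let Φ : (Fin n → ℝ) →ₗ[ℝ] (Fin m → ℝ) × (Fin n → ℝ) :=
    (Matrix.mulVecLin A).prod
      (LinearMap.pi fun i => (if xs i = 0 then (1 : ℝ) else 0) • LinearMap.proj i)
  have hker : LinearMap.ker Φ = ⊥ := by
    refine LinearMap.ker_eq_bot'.2 fun d hd => ?_
    have h1 : A *ᵥ d = 0 := congrArg Prod.fst hd
    have h2 : ∀ i, (if xs i = 0 then (1 : ℝ) else 0) • d i = 0 := fun i =>
      congrFun (congrArg Prod.snd hd) i
    refine eq_zero_of_mem_extremePoints hext h1 fun i hi => ?_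
    have := h2 i
    rwa [if_pos hi, one_smul] at this
  obtain ⟨C, hC, hanti⟩ := LinearMap.exists_antilipschitzWith Φ hker
  refine ⟨C, by exact_mod_cast hC, fun x hx => ?_⟩
  have h1 := hanti.le_mul_dist (x - xs) 0
  rw [map_zero, dist_zero_right, dist_zero_right] at h1
  refine h1.trans (mul_le_mul_of_nonneg_left ?_ C.2)
  have hS : 0 ≤ activeSum xs x := activeSum_nonneg hx
  rw [Prod.norm_def]
  refine max_le ?_ ?_
  · change ‖A *ᵥ (x - xs)‖ ≤ _
    rw [mulVec_sub_eq_zero hx hext.1, norm_zero]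
    exact hS
  · refine (pi_norm_le_iff_of_nonneg hS).2 fun i => ?_
    change ‖(if xs i = 0 then (1 : ℝ) else 0) • (x i - xs i)‖ ≤ _
    by_cases hi : xs i = 0
    · rw [if_pos hi, one_smul, hi, sub_zero, Real.norm_of_nonneg (hx.1 i)]
      exact Finset.single_le_sum (f := x) (fun j _ => hx.1 j) (by simp [hi])
    · rw [if_neg hi, zero_smul, norm_zero]
      exact hS

theorem dotProduct_eq_zero_of_mem_rowSpace {w d : Fin n → ℝ} (hw : w ∈ rowSpace A)
    (hd : A *ᵥ d = 0) : w ⬝ᵥ d = 0 := by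
  induction hw using Submodule.span_induction with
  | mem x hx =>
    obtain ⟨k, rfl⟩ := hx
    exact congrFun hd k
  | zero => simp
  | add x y _ _ hx hy => rw [add_dotProduct, hx, hy, add_zero]
  | smul r x _ hx => rw [smul_dotProduct, hx, smul_zero]

theorem IsSlackness.dotProduct_eq {v : (Fin n → ℝ) → (Fin n → ℝ)} (hs : IsSlackness A v xs s)
    {d : Fin n → ℝ} (hd : A *ᵥ d = 0) : v xs ⬝ᵥ d = ∑ i with xs i = 0, s i * d i := by
  have h1 := dotProduct_eq_zero_of_mem_rowSpace hs.2 hd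
  rw [sub_dotProduct, sub_eq_zero] at h1
  rw [h1, sum_dotProduct, Finset.sum_filter, Finset.sum_filter]
  refine Finset.sum_congr rfl fun i _ => ?_
  simp [active]

theorem IsSharp.sharpness_pos (hsharp : IsSharp A c xs s) (hne : ∃ i, xs i = 0) :
    0 < sharpness xs s := by
  obtain ⟨i, hi⟩ := hne
  have hne : (s '' sharpDirs xs s).Nonempty := by
    rw [hsharp.1]
    exact ⟨_, i, hi, rfl⟩
  obtain ⟨j, hj, hje⟩ := hne.csInf_mem (Set.toFinite _)
  rw [sharpness, ← hje]
  exact hj.2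

theorem IsSharp.sharpness_le (hsharp : IsSharp A c xs s) {i : Fin n} (hi : xs i = 0) :
    sharpness xs s ≤ s i := by
  refine csInf_le (Set.toFinite _).bddBelow ⟨i, ?_, rfl⟩
  rw [hsharp.1]
  exact hi

theorem IsSharp.sharpness_mul_activeSum_le (hsharp : IsSharp A c xs s)
    {v : (Fin n → ℝ) → (Fin n → ℝ)} (hs : IsSlackness A v xs s) {x : Fin n → ℝ}
    (hx : x ∈ polyhedron A c) : sharpness xs s * activeSum xs x ≤ v xs ⬝ᵥ (x - xs) := by
  rw [hs.dotProduct_eq (mulVec_sub_eq_zero hx hsharp.2.1), activeSum, Finset.mul_sum]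
  refine Finset.sum_le_sum fun i hi => ?_
  have hi' : xs i = 0 := by simpa using hi
  rw [Pi.sub_apply, hi', sub_zero]
  exact mul_le_mul_of_nonneg_right (hsharp.sharpness_le hi') (hx.1 i)

/-- Near a sharp solution, the field still points away from it at half of the sharpness. -/
theorem IsSharp.half_sharpness_mul_activeSum_le {N : Seminorm ℝ (Fin n → ℝ)}
    (hN : ∀ x, N x = 0 → x = 0) (hsharp : IsSharp A c xs s)
    {v : (Fin n → ℝ) → (Fin n → ℝ)} (hs : IsSlackness A v xs s) {L : ℝ} (hL : 0 < L)
    (hLip : IsLipschitzField N (polyhedron A c) v L) {C r : ℝ}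
    (hC : ∀ x ∈ polyhedron A c, N (x - xs) ≤ C * activeSum xs x)
    (hr : 0 ≤ r) (hrσ : L * r * C ≤ sharpness xs s / 2)
    {x y : Fin n → ℝ} (hx : x ∈ polyhedron A c) (hy : y ∈ polyhedron A c)
    (hyr : N (y - xs) ≤ r) :
    sharpness xs s / 2 * activeSum xs x ≤ v y ⬝ᵥ (x - xs) := by
  have h1 := hsharp.sharpness_mul_activeSum_le hs hx
  have h2 := hLip.dotProduct_le hN hy hsharp.2.1 (x - xs)
  rw [sub_dotProduct, map_sub_rev N xs] at h2
  have h3 : L * N (y - xs) * N (x - xs) ≤ sharpness xs s / 2 * activeSum xs x :=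
    calc L * N (y - xs) * N (x - xs) ≤ L * r * (C * activeSum xs x) := by
          gcongr
          exact hC x hx
      _ = L * r * C * activeSum xs x := by ring
      _ ≤ _ := mul_le_mul_of_nonneg_right hrσ (activeSum_nonneg hx)
  linarith

end Polyhedron

/-! ### Prox-domain and divergence of a decomposable regularizer. -/

section Decomposable

variable {m n : ℕ} {A : Matrix (Fin m) (Fin n) ℝ} {c : Fin m → ℝ} {xs : Fin n → ℝ}
  {h : (Fin n → ℝ) → ℝ} {gradh : (Fin n → ℝ) → (Fin n → ℝ)} {θ : ℝ → ℝ}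
  {N : Seminorm ℝ (Fin n → ℝ)}

theorem IsDecomposable.mem_proxDom (hdec : IsDecomposable (polyhedron A c) h θ) {x : Fin n → ℝ}
    (hx : x ∈ polyhedron A c) (hpos : ∀ i, 0 < x i ∨ SlopeBounded θ) :
    x ∈ proxDom (polyhedron A c) h := by
  have hcoord : ∀ i, ∃ g, ∀ z, 0 ≤ z → θ (x i) + g * (z - x i) ≤ θ z := by
    intro i
    by_cases hi : 0 < x i
    · exact ⟨deriv θ (x i), fun z hz => hdec.1.tangent_le hi hz⟩
    · obtain ⟨C, hC⟩ := (hpos i).resolve_left hi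
      have hi0 : x i = 0 := le_antisymm (not_lt.1 hi) (hx.1 i)
      refine ⟨-C, fun z hz => ?_⟩
      rw [hi0]
      linarith [hC z hz]
  choose g hg using hcoord
  refine ⟨g, hx, fun y hy => ?_⟩
  rw [hdec.2 x hx, hdec.2 y hy, dotProduct, ← Finset.sum_add_distrib]
  exact Finset.sum_le_sum fun i _ => hg i (y i) (hy.1 i)

theorem IsKernel.segment_le (hθ : IsKernel θ) {x y t : ℝ} (hx : 0 ≤ x) (hy : 0 ≤ y) (ht : 0 ≤ t)
    (ht1 : t ≤ 1) : θ (x + t * (y - x)) - θ x ≤ t * (θ y - θ x) := by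
  have h1 := hθ.convexOn.2 hx hy (sub_nonneg.2 ht1) ht (by ring)
  simp only [smul_eq_mul] at h1
  have e : (1 - t) * x + t * y = x + t * (y - x) := by ring
  rw [e] at h1
  linarith

theorem IsKernel.slopeBounded_of_segment (hθ : IsKernel θ) {w C : ℝ} (hw : 0 < w)
    (hC : ∀ t, 0 ≤ t → t ≤ 1 → -(t * C) ≤ θ (t * w) - θ 0) : SlopeBounded θ := by
  refine ⟨C / w, fun z hz => ?_⟩
  rcases le_or_gt z w with hzw | hzw
  · have h1 := hC (z / w) (by positivity) ((div_le_one hw).2 hzw)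
    rw [div_mul_cancel₀ _ hw.ne'] at h1
    have e : C / w * z = z / w * C := by ring
    linarith
  -- Beyond `w`, convexity on `[0, z]` carries the bound at `w` out to `z`.
  · have hz0 : 0 < z := hw.trans hzw
    have h1 := hC 1 zero_le_one le_rfl
    rw [one_mul, one_mul] at h1
    have h2 := hθ.segment_le le_rfl hz (t := w / z) (by positivity) ((div_le_one hz0).2 hzw.le)
    rw [sub_zero, zero_add, div_mul_cancel₀ _ hz0.ne'] at h2
    have h3 : -C ≤ w / z * (θ z - θ 0) := h1.trans h2
    rw [div_mul_eq_mul_div, le_div_iff₀ hz0] at h3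
    have h4 : -C / w * z ≤ θ z - θ 0 := by
      rw [div_mul_eq_mul_div, div_le_iff₀ hw]
      linarith
    have e : -C / w * z = -(C / w * z) := by ring
    linarith

/-- Moving from `x` toward the Slater point raises `θ` in the other coordinates at most linearly in
`t`. The subgradient inequality then prevents `θ` from falling faster than linearly in coordinate
`i`. -/
theorem IsDecomposable.slopeBounded (hdec : IsDecomposable (polyhedron A c) h θ)
    (hSlater : ∃ x ∈ polyhedron A c, ∀ i, 0 < x i) {x : Fin n → ℝ}
    (hx : x ∈ proxDom (polyhedron A c) h) {i : Fin n} (hi : x i = 0) : SlopeBounded θ := by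
  obtain ⟨w, hw, hwpos⟩ := hSlater
  obtain ⟨g, hxK, hg⟩ := hx
  refine hdec.1.slopeBounded_of_segment (hwpos i)
    (C := (∑ j ∈ Finset.univ.erase i, (θ (w j) - θ (x j))) - g ⬝ᵥ (w - x)) fun t ht ht1 => ?_
  have hmem := add_smul_sub_mem_polyhedron hxK hw ht ht1
  have h1 := hg _ hmem
  rw [add_sub_cancel_left, dotProduct_smul, smul_eq_mul, hdec.2 _ hxK, hdec.2 _ hmem,
    ← Finset.add_sum_erase _ _ (Finset.mem_univ i),
    ← Finset.add_sum_erase _ (fun j => θ ((x + t • (w - x)) j)) (Finset.mem_univ i)] at h1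
  have h2 : ∑ j ∈ Finset.univ.erase i, θ ((x + t • (w - x)) j)
      - ∑ j ∈ Finset.univ.erase i, θ (x j)
      ≤ t * ∑ j ∈ Finset.univ.erase i, (θ (w j) - θ (x j)) := by
    rw [← Finset.sum_sub_distrib, Finset.mul_sum]
    exact Finset.sum_le_sum fun j _ =>
      hdec.1.segment_le (hxK.1 j) (hw.1 j) ht ht1
  simp only [Pi.add_apply, Pi.smul_apply, Pi.sub_apply, smul_eq_mul, hi, zero_add,
    sub_zero] at h1 h2
  linarith

theorem IsDecomposable.pos_of_mem_proxDom (hdec : IsDecomposable (polyhedron A c) h θ)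
    (hSlater : ∃ x ∈ polyhedron A c, ∀ i, 0 < x i) (hθ : ¬ SlopeBounded θ) {x : Fin n → ℝ}
    (hx : x ∈ proxDom (polyhedron A c) h) (i : Fin n) : 0 < x i :=
  lt_of_le_of_ne ((mem_of_mem_proxDom hx).1 i) fun hi => hθ (hdec.slopeBounded hSlater hx hi.symm)

/-- The prox-domain is the whole polyhedron, or consists of its positive points when slopes are
unbounded. Either way, moving from one of its points toward `p`, short of `p`, stays inside. -/
theorem IsDecomposable.isMaximalSelection (hdec : IsDecomposable (polyhedron A c) h θ)
    (hSlater : ∃ x ∈ polyhedron A c, ∀ i, 0 < x i)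
    (hreg : IsRegularizer N (polyhedron A c) h gradh) :
    IsMaximalSelection (polyhedron A c) h gradh := by
  refine IsMaximalSelection.of_segment hreg fun x hx p hp t ht ht1 => ?_
  have hxK := mem_of_mem_proxDom hx
  refine hdec.mem_proxDom (add_smul_sub_mem_polyhedron hxK hp ht ht1.le) fun i => ?_
  by_cases hθ : SlopeBounded θ
  · exact Or.inr hθ
  · left
    have h1 := hdec.pos_of_mem_proxDom hSlater hθ hx i
    have h2 := hp.1 i
    simp only [Pi.add_apply, Pi.smul_apply, Pi.sub_apply, smul_eq_mul]
    nlinarith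

/-- At a positive point, every subgradient acts on feasible directions as the gradient. -/
theorem IsDecomposable.dotProduct_eq_of_mem_subdiff (hdec : IsDecomposable (polyhedron A c) h θ)
    {x g d : Fin n → ℝ} (hpos : ∀ i, 0 < x i) (hg : g ∈ subdiff (polyhedron A c) h x)
    (hd : A *ᵥ d = 0) : g ⬝ᵥ d = ∑ i, deriv θ (x i) * d i := by
  have hderiv : HasDerivAt (fun t : ℝ => ∑ i, θ (x i + t * d i) - t * (g ⬝ᵥ d))
      (∑ i, deriv θ (x i) * d i - g ⬝ᵥ d) 0 := by
    have h1 : HasDerivAt (fun t : ℝ => ∑ i, θ (x i + t * d i)) (∑ i, deriv θ (x i) * d i) 0 := by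
      refine HasDerivAt.fun_sum fun i _ => ?_
      have h2 : HasDerivAt (fun t : ℝ => x i + t * d i) (d i) 0 := by
        simpa using ((hasDerivAt_id (0 : ℝ)).mul_const (d i)).const_add (x i)
      have h3 : HasDerivAt θ (deriv θ (x i)) (x i + 0 * d i) := by
        simpa using hdec.1.hasDerivAt (hpos i)
      exact h3.comp (0 : ℝ) h2
    have h4 : HasDerivAt (fun t : ℝ => t * (g ⬝ᵥ d)) (g ⬝ᵥ d) 0 := by
      simpa using (hasDerivAt_id (0 : ℝ)).mul_const (g ⬝ᵥ d)
    exact h1.sub h4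
  -- Positivity makes both `d` and `-d` feasible, so the subgradient inequality gives a two-sided
  -- minimum.
  have hmin : IsLocalMin (fun t : ℝ => ∑ i, θ (x i + t * d i) - t * (g ⬝ᵥ d)) 0 := by
    have hev : ∀ᶠ t : ℝ in 𝓝 0, ∀ i, 0 < x i + t * d i := by
      refine eventually_all.2 fun i => ?_
      have hc : Continuous fun t : ℝ => x i + t * d i := by fun_prop
      have h0 : 0 < x i + 0 * d i := by simpa using hpos i
      exact hc.continuousAt.eventually (lt_mem_nhds h0)
    filter_upwards [hev] with t ht
    have hmem : x + t • d ∈ polyhedron A c := by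
      refine ⟨fun i => (ht i).le, ?_⟩
      rw [mulVec_add, mulVec_smul, hd, hg.1.2, smul_zero, add_zero]
    have h1 := hg.2 _ hmem
    rw [add_sub_cancel_left, dotProduct_smul, smul_eq_mul, hdec.2 _ hg.1, hdec.2 _ hmem] at h1
    simp only [Pi.add_apply, Pi.smul_apply, smul_eq_mul] at h1
    simp only [zero_mul, add_zero, sub_zero]
    linarith
  have := hmin.hasDerivAt_eq_zero hderiv
  linarith

theorem IsDecomposable.continuousOn (hdec : IsDecomposable (polyhedron A c) h θ) :
    ContinuousOn h (polyhedron A c) := by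
  have : ContinuousOn (fun x : Fin n → ℝ => ∑ i, θ (x i)) (polyhedron A c) := by
    refine continuousOn_finsetSum _ fun i _ => ?_
    exact hdec.1.cont.comp (continuous_apply i).continuousOn fun x hx => hx.1 i
  exact this.congr hdec.2

theorem IsKernel.tendsto_divergence (hθ : IsKernel θ) {p : ℝ} (hp : 0 ≤ p) :
    Tendsto (fun z => θ p - θ z - deriv θ z * (p - z)) (𝓝[Set.Ioi 0] p) (𝓝 0) := by
  have h0 : Tendsto θ (𝓝[Set.Ioi 0] p) (𝓝 (θ p)) :=
    (hθ.cont p hp).mono_left (nhdsWithin_mono _ Set.Ioi_subset_Ici_self)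
  have h1 : Tendsto (fun z => θ p - θ z) (𝓝[Set.Ioi 0] p) (𝓝 0) := by
    simpa using h0.const_sub (θ p)
  rcases hp.eq_or_lt with rfl | hp
  · have := h1.add hθ.tendsto_mul_deriv
    simp only [add_zero] at this
    refine this.congr fun z => ?_
    ring
  · have h2 : Tendsto (fun z => deriv θ z * (p - z)) (𝓝[Set.Ioi 0] p)
        (𝓝 (deriv θ p * (p - p))) := by
      refine (hθ.continuousOn_deriv p hp).tendsto.mul ?_
      have : Continuous fun z : ℝ => p - z := by fun_prop
      exact (this.tendsto p).mono_left nhdsWithin_le_nhds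
    have := h1.sub h2
    simpa using this

/-- Turns closeness in norm into small initial energy. With bounded slopes `gradh` is continuous at
`xs`; otherwise it need not be controlled there, and the divergence is split into coordinates. -/
theorem IsDecomposable.tendsto_breg (hdec : IsDecomposable (polyhedron A c) h θ)
    (hSlater : ∃ x ∈ polyhedron A c, ∀ i, 0 < x i)
    (hreg : IsRegularizer N (polyhedron A c) h gradh) (hxs : xs ∈ polyhedron A c) :
    Tendsto (fun x => breg h gradh xs x) (𝓝[proxDom (polyhedron A c) h] xs) (𝓝 0) := by
  by_cases hθ : SlopeBounded θ
  · have hxd := hdec.mem_proxDom hxs fun i => Or.inr hθ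
    have h1 : Tendsto h (𝓝[proxDom (polyhedron A c) h] xs) (𝓝 (h xs)) :=
      (hdec.continuousOn xs hxs).mono_left (nhdsWithin_mono _ fun x hx => mem_of_mem_proxDom hx)
    have h2 : Tendsto gradh (𝓝[proxDom (polyhedron A c) h] xs) (𝓝 (gradh xs)) :=
      hreg.selection_cont xs hxd
    have h3 : Tendsto (fun x => xs - x) (𝓝[proxDom (polyhedron A c) h] xs) (𝓝 (xs - xs)) := by
      have : Continuous fun x : Fin n → ℝ => xs - x := by fun_prop
      exact (this.tendsto xs).mono_left nhdsWithin_le_nhds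
    have h4 : Tendsto (fun x => gradh x ⬝ᵥ (xs - x)) (𝓝[proxDom (polyhedron A c) h] xs)
        (𝓝 (gradh xs ⬝ᵥ (xs - xs))) := by
      have : Continuous fun q : (Fin n → ℝ) × (Fin n → ℝ) => q.1 ⬝ᵥ q.2 := by fun_prop
      exact (this.tendsto (gradh xs, xs - xs)).comp (h2.prodMk_nhds h3)
    have h5 := (h1.const_sub (h xs)).sub h4
    simp only [sub_self, dotProduct_zero] at h5
    exact h5
  · have h1 : Tendsto (fun x : Fin n → ℝ => ∑ i, (θ (xs i) - θ (x i)
        - deriv θ (x i) * (xs i - x i))) (𝓝[proxDom (polyhedron A c) h] xs) (𝓝 (∑ _i : Fin n, 0)) := by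
      refine tendsto_finsetSum _ fun i _ => ?_
      have h2 : Tendsto (fun x : Fin n → ℝ => x i) (𝓝[proxDom (polyhedron A c) h] xs)
          (𝓝[Set.Ioi 0] (xs i)) := by
        refine tendsto_nhdsWithin_iff.2
          ⟨((continuous_apply i).tendsto xs).mono_left nhdsWithin_le_nhds, ?_⟩
        filter_upwards [self_mem_nhdsWithin] with x hx
        exact hdec.pos_of_mem_proxDom hSlater hθ hx i
      exact (hdec.1.tendsto_divergence (hxs.1 i)).comp h2
    rw [Finset.sum_const_zero] at h1
    refine h1.congr' ?_
    filter_upwards [self_mem_nhdsWithin] with x hx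
    have hxK := mem_of_mem_proxDom hx
    rw [breg, hdec.dotProduct_eq_of_mem_subdiff
      (hdec.pos_of_mem_proxDom hSlater hθ hx) (hreg.selection_mem x hx)
      (mulVec_sub_eq_zero hxs hxK), hdec.2 _ hxs, hdec.2 _ hxK, ← Finset.sum_sub_distrib,
      ← Finset.sum_sub_distrib]
    rfl

end Decomposable

/-! ### From weighted sums to bounds on the plain sum. -/

section SumEstimates

variable {ι : Type*} {S : Finset ι} {x : ι → ℝ}

/-- Termwise, `log u ≤ u - 1` at `u = exp E / x` gives `x - exp E ≤ x log x - E x`. -/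
theorem sum_le_card_mul_exp (hx : ∀ i ∈ S, 0 < x i) {E : ℝ}
    (hE : ∑ i ∈ S, x i * Real.log (x i) ≤ E * ∑ i ∈ S, x i) :
    ∑ i ∈ S, x i ≤ S.card * Real.exp E := by
  have h1 : ∑ i ∈ S, (x i - Real.exp E) ≤ ∑ i ∈ S, (x i * Real.log (x i) - E * x i) := by
    refine Finset.sum_le_sum fun i hi => ?_
    have hxi := hx i hi
    have h2 := Real.log_le_sub_one_of_pos (x := Real.exp E / x i) (by positivity)
    rw [Real.log_div (Real.exp_pos E).ne' hxi.ne', Real.log_exp] at h2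
    have h3 := mul_le_mul_of_nonneg_left h2 hxi.le
    have h4 : x i * (Real.exp E / x i - 1) = Real.exp E - x i := by field_simp
    linarith
  rw [Finset.sum_sub_distrib, Finset.sum_sub_distrib, ← Finset.mul_sum, Finset.sum_const,
    nsmul_eq_mul] at h1
  linarith

/-- The threshold `y` solves `C y^(-q) = R/2`. Above it the power term is at most `x R/2`; below it,
`q < 1` makes `x^(1-q)` increasing, so it is at most `y R/2`. -/
theorem sum_le_card_mul_rpow (hx : ∀ i ∈ S, 0 < x i) {q C R : ℝ} (hq : 0 < q) (hq1 : q < 1)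
    (hC : 0 < C) (hR : 0 < R)
    (hE : ∑ i ∈ S, x i * (-C * x i ^ (-q)) ≤ -R * ∑ i ∈ S, x i) :
    ∑ i ∈ S, x i ≤ 2 * S.card * (R / (2 * C)) ^ (-1 / q) := by
  set y := (R / (2 * C)) ^ (-1 / q) with hy
  have hy0 : 0 < y := Real.rpow_pos_of_pos (by positivity) _
  have hyq : y ^ (-q) = R / (2 * C) := by
    rw [hy, ← Real.rpow_mul (by positivity)]
    have : -1 / q * -q = 1 := by field_simp
    rw [this, Real.rpow_one]
  have h1 : ∑ i ∈ S, (x i - 2 * y) * (R / 2)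
      ≤ ∑ i ∈ S, (x i * (-C * x i ^ (-q)) + R * x i) := by
    refine Finset.sum_le_sum fun i hi => ?_
    have hxi := hx i hi
    rcases le_total y (x i) with hle | hle
    · have h2 : x i ^ (-q) ≤ R / (2 * C) := by
        rw [← hyq]
        exact Real.rpow_le_rpow_of_nonpos hy0 hle (by linarith)
      have h3 : C * x i ^ (-q) ≤ R / 2 := by
        calc _ ≤ C * (R / (2 * C)) := mul_le_mul_of_nonneg_left h2 hC.le
          _ = R / 2 := by field_simp
      have h4 := mul_le_mul_of_nonneg_left h3 hxi.le
      have h5 : 0 < y * R := by positivity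
      linarith
    · have h2 : x i * x i ^ (-q) ≤ y * y ^ (-q) := by
        have e : ∀ z : ℝ, 0 < z → z * z ^ (-q) = z ^ (1 - q) := fun z hz => by
          rw [sub_eq_add_neg, Real.rpow_add hz, Real.rpow_one]
        rw [e _ hxi, e _ hy0]
        exact Real.rpow_le_rpow hxi.le hle (by linarith)
      rw [hyq] at h2
      have h3 : C * (x i * x i ^ (-q)) ≤ y * (R / 2) := by
        calc _ ≤ C * (y * (R / (2 * C))) := mul_le_mul_of_nonneg_left h2 hC.le
          _ = y * (R / 2) := by field_simp
      have h4 : 0 ≤ (y - x i) * R := mul_nonneg (by linarith) hR.le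
      have h5 : 0 < x i * R := by positivity
      linarith
  rw [← Finset.sum_mul, Finset.sum_sub_distrib, Finset.sum_add_distrib, ← Finset.mul_sum S x R,
    Finset.sum_const, nsmul_eq_mul] at h1
  have h2 : (∑ i ∈ S, x i - S.card * (2 * y)) * (R / 2) ≤ 0 := by linarith
  have h3 : ∑ i ∈ S, x i - S.card * (2 * y) ≤ 0 := by
    by_contra hlt
    have := mul_pos (not_le.1 hlt) (half_pos hR)
    linarith
  linarith

end SumEstimates

/-! ### Finite termination and dual telescoping. -/

section Convergence

variable {m n : ℕ} {A : Matrix (Fin m) (Fin n) ℝ} {c : Fin m → ℝ} {xs s : Fin n → ℝ}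
  {h : (Fin n → ℝ) → ℝ} {gradh v : (Fin n → ℝ) → (Fin n → ℝ)} {θ : ℝ → ℝ}
  {N : Seminorm ℝ (Fin n → ℝ)} {L μ γ a b : ℝ}

/-- A sharp solution without active constraints is the only point of the polyhedron. -/
theorem eq_of_forall_ne_zero (hext : xs ∈ (polyhedron A c).extremePoints ℝ)
    (hne : ∀ i, xs i ≠ 0) {x : Fin n → ℝ} (hx : x ∈ polyhedron A c) : x = xs :=
  sub_eq_zero.1 (eq_zero_of_mem_extremePoints hext (mulVec_sub_eq_zero hx hext.1)
    fun i hi => absurd hi (hne i))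

theorem IsBPM.mem_proxDom {K : Set (Fin n → ℝ)} {X Y : ℕ → (Fin n → ℝ)}
    (hXY : IsBPM K h gradh v γ a b X Y) {t : ℕ} (ht : 1 ≤ t) : X t ∈ proxDom K h := by
  induction t, ht using Nat.le_induction with
  | base => exact hXY.init_mem
  | succ t ht _ => exact (hXY.base_step t ht).mem_proxDom

/-- If the solution lies in the prox-domain, then a base step from a point near it lands on it. -/
theorem exists_base_step_eq (hN : ∀ x, N x = 0 → x = 0)
    (hreg : IsRegularizer N (polyhedron A c) h gradh)
    (hsel : IsMaximalSelection (polyhedron A c) h gradh)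
    (hxs : xs ∈ proxDom (polyhedron A c) h) (hext : xs ∈ (polyhedron A c).extremePoints ℝ)
    (hγ : 0 < γ) {σ : ℝ} (hσ : 0 < σ) :
    ∃ r, 0 < r ∧ ∀ x ∈ proxDom (polyhedron A c) h, ∀ y x', N (x - xs) ≤ r → N (x' - xs) ≤ r →
      IsProx (polyhedron A c) h gradh x (-(γ • v y)) x' →
      σ / 2 * activeSum xs x' ≤ v y ⬝ᵥ (x' - xs) → x' = xs := by
  obtain ⟨C, hC, hCle⟩ := exists_norm_sub_le_activeSum hext
  -- Makes `(n + 1) · 2η · C = γσ/4`, half of the drift `γσ/2`, which forces the active sum to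
  -- vanish.
  set η := γ * σ / (8 * (n + 1) * C) with hη
  have hη0 : 0 < η := by positivity
  have hev : ∀ᶠ x in 𝓝[proxDom (polyhedron A c) h] xs, ‖gradh x - gradh xs‖ < η := by
    have := (hreg.selection_cont xs hxs).eventually (Metric.ball_mem_nhds _ hη0)
    simpa only [dist_eq_norm] using this
  obtain ⟨r, hr, hball⟩ := exists_seminorm_ball_of_eventually hN hev
  refine ⟨r, hr, fun x hx y x' hxr hxr' hp hdrift => ?_⟩
  have hx'K := hp.1
  have h1 := hp.optimality hsel (mem_of_mem_proxDom hxs)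
  have h2 := hball x hx hxr
  have h3 := hball x' hp.mem_proxDom hxr'
  have h4 : γ * (v y ⬝ᵥ (x' - xs)) ≤ (gradh x - gradh x') ⬝ᵥ (x' - xs) := by
    simp only [add_dotProduct, neg_dotProduct, smul_dotProduct, smul_eq_mul, sub_dotProduct,
      dotProduct_sub] at h1 ⊢
    linarith
  have h5 : ∑ i, |(gradh x - gradh x') i| ≤ (n + 1) * (2 * η) := by
    calc ∑ i, |(gradh x - gradh x') i| ≤ ∑ _i : Fin n, 2 * η := by
          refine Finset.sum_le_sum fun i _ => (norm_le_pi_norm (gradh x - gradh x') i).trans ?_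
          have := norm_sub_le_norm_sub_add_norm_sub (gradh x) (gradh xs) (gradh x')
          rw [norm_sub_rev (gradh xs)] at this
          linarith
      _ = n * (2 * η) := by simp
      _ ≤ (n + 1) * (2 * η) := by
          gcongr
          linarith
  set S := activeSum xs x' with hS
  have hS0 : 0 ≤ S := activeSum_nonneg hx'K
  have h6 : (gradh x - gradh x') ⬝ᵥ (x' - xs) ≤ γ * σ / 4 * S :=
    calc _ ≤ (∑ i, |(gradh x - gradh x') i|) * ‖x' - xs‖ := dotProduct_le_sum_mul_norm _ _
      _ ≤ (n + 1) * (2 * η) * (C * S) := by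
          gcongr
          exact hCle x' hx'K
      _ = γ * σ / 4 * S := by
          rw [hη]
          field_simp
          ring
  have h7 := mul_le_mul_of_nonneg_left hdrift hγ.le
  have h8 : γ * σ * S ≤ 0 := by linarith
  have h9 : S ≤ 0 := by
    by_contra hlt
    have := mul_pos (mul_pos hγ hσ) (not_le.1 hlt)
    linarith
  have h10 : ‖x' - xs‖ ≤ 0 := (hCle x' hx'K).trans (mul_nonpos_of_nonneg_of_nonpos hC.le h9)
  exact sub_eq_zero.1 (norm_le_zero_iff.1 h10)

/-- The dual iterates of the method, for a kernel which keeps the base states positive. -/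
theorem IsBPM.sum_deriv_mul_eq (hdec : IsDecomposable (polyhedron A c) h θ)
    (hSlater : ∃ x ∈ polyhedron A c, ∀ i, 0 < x i) (hθ : ¬ SlopeBounded θ)
    (hreg : IsRegularizer N (polyhedron A c) h gradh) {X Y : ℕ → (Fin n → ℝ)}
    (hXY : IsBPM (polyhedron A c) h gradh v γ a b X Y) {d : Fin n → ℝ} (hd : A *ᵥ d = 0) (t : ℕ) :
    ∑ i, deriv θ (X (t + 1) i) * d i =
      ∑ i, deriv θ (X 1 i) * d i - γ * ∑ k ∈ Finset.range t, v (Y (k + 1)) ⬝ᵥ d := by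
  induction t with
  | zero => simp
  | succ t ih =>
    have hp := hXY.base_step (t + 1) (Nat.le_add_left 1 t)
    have h1 := hXY.mem_proxDom (Nat.le_add_left 1 t)
    -- At positive points all subgradients agree on the kernel of `A`, so the prox step is an exact
    -- additive recursion there.
    rw [← hdec.dotProduct_eq_of_mem_subdiff (hdec.pos_of_mem_proxDom hSlater hθ h1)
      (hreg.selection_mem _ h1) hd] at ih
    rw [← hdec.dotProduct_eq_of_mem_subdiff (hdec.pos_of_mem_proxDom hSlater hθ hp.mem_proxDom)
      hp.mem_subdiff hd, add_dotProduct, neg_dotProduct, smul_dotProduct, smul_eq_mul, ih,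
      Finset.sum_range_succ]
    ring

/-- Near the solution, the inactive coordinates contribute to the gradient at most
proportionally to the active ones. -/
theorem exists_inactive_bound (hθ : IsKernel θ) (hxs : xs ∈ polyhedron A c) {C ρ : ℝ} (hC : 0 ≤ C)
    (hCle : ∀ x ∈ polyhedron A c, ‖x - xs‖ ≤ C * activeSum xs x)
    (hρ : ∀ i, xs i ≠ 0 → ρ ≤ xs i / 2) :
    ∃ M, 0 ≤ M ∧ ∀ x ∈ polyhedron A c, ‖x - xs‖ ≤ ρ →
      ∑ i with xs i = 0, x i * deriv θ (x i) ≤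
        ∑ i, deriv θ (x i) * (x - xs) i + M * activeSum xs x := by
  -- Within `ρ` of `xs`, inactive coordinates stay in `[xs i / 2, 2 xs i]`, where monotone `θ'` is
  -- bounded by its end values. For active `i` the value of `deriv θ` at 0 is immaterial: the term
  -- only has to be nonnegative.
  refine ⟨∑ i, (|deriv θ (xs i / 2)| + |deriv θ (2 * xs i)|) * C, by positivity,
    fun x hx hxρ => ?_⟩
  rw [Finset.sum_filter, Finset.sum_mul, ← Finset.sum_add_distrib]
  refine Finset.sum_le_sum fun i _ => ?_
  have hS0 : 0 ≤ activeSum xs x := activeSum_nonneg hx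
  split_ifs with hi
  · rw [Pi.sub_apply, hi, sub_zero, mul_comm]
    have : 0 ≤ (|deriv θ (0 / 2)| + |deriv θ (2 * 0)|) * C * activeSum xs x := by positivity
    linarith
  · have hpos : 0 < xs i := lt_of_le_of_ne (hxs.1 i) (Ne.symm hi)
    have h1 : |(x - xs) i| ≤ ‖x - xs‖ := norm_le_pi_norm (x - xs) i
    have h2 := abs_le.1 (h1.trans (hxρ.trans (hρ i hi)))
    rw [Pi.sub_apply] at h2
    have h3 : |deriv θ (x i)| ≤ |deriv θ (xs i / 2)| + |deriv θ (2 * xs i)| := by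
      have i1 := hθ.deriv_mono (z := xs i / 2) (w := x i) (by linarith) (by linarith)
      have i2 := hθ.deriv_mono (z := x i) (w := 2 * xs i) (by linarith) (by linarith)
      refine abs_le.2 ⟨?_, ?_⟩
      · linarith [neg_abs_le (deriv θ (xs i / 2)), abs_nonneg (deriv θ (2 * xs i))]
      · linarith [le_abs_self (deriv θ (2 * xs i)), abs_nonneg (deriv θ (xs i / 2))]
    have h4 : |deriv θ (x i) * (x - xs) i| ≤
        (|deriv θ (xs i / 2)| + |deriv θ (2 * xs i)|) * C * activeSum xs x := by
      rw [abs_mul, mul_assoc]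
      exact mul_le_mul h3 (h1.trans (hCle x hx)) (abs_nonneg _) (by positivity)
    linarith [neg_abs_le (deriv θ (x i) * (x - xs) i)]

/-- The gradients of the active coordinates decrease linearly in time, on average. -/
theorem IsBPM.exists_active_sum_le (hdec : IsDecomposable (polyhedron A c) h θ)
    (hSlater : ∃ x ∈ polyhedron A c, ∀ i, 0 < x i) (hθ : ¬ SlopeBounded θ)
    (hreg : IsRegularizer N (polyhedron A c) h gradh) (hxs : xs ∈ polyhedron A c)
    {C ρ σ : ℝ} (hC : 0 ≤ C) (hCle : ∀ x ∈ polyhedron A c, ‖x - xs‖ ≤ C * activeSum xs x)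
    (hρ : ∀ i, xs i ≠ 0 → ρ ≤ xs i / 2) (hγ : 0 < γ) {X Y : ℕ → (Fin n → ℝ)}
    (hXY : IsBPM (polyhedron A c) h gradh v γ a b X Y)
    (hXρ : ∀ t, 1 ≤ t → ‖X t - xs‖ ≤ ρ)
    (hdrift : ∀ t, 1 ≤ t → ∀ x ∈ polyhedron A c,
      σ / 2 * activeSum xs x ≤ v (Y t) ⬝ᵥ (x - xs)) :
    ∃ M, 0 ≤ M ∧ ∀ t : ℕ, 1 ≤ t → ∑ i with xs i = 0, X t i * deriv θ (X t i) ≤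
      (M - γ * σ * t / 2) * activeSum xs (X t) := by
  obtain ⟨M, hM, hMle⟩ := exists_inactive_bound hdec.1 hxs hC hCle hρ
  -- Beyond the inactive coordinates, `M` absorbs the initial gradient and one drift term, since `X
  -- t` has made only `t - 1` base steps.
  refine ⟨M + (∑ i, |deriv θ (X 1 i)|) * C + |γ * σ / 2|, by positivity, fun t ht => ?_⟩
  obtain ⟨k, rfl⟩ : ∃ k, t = k + 1 := ⟨t - 1, by omega⟩
  have hXK := mem_of_mem_proxDom (hXY.mem_proxDom ht)
  have h1 := hMle _ hXK (hXρ _ ht)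
  rw [hXY.sum_deriv_mul_eq hdec hSlater hθ hreg (mulVec_sub_eq_zero hXK hxs)] at h1
  have h2 : ∑ i, deriv θ (X 1 i) * (X (k + 1) - xs) i ≤
      (∑ i, |deriv θ (X 1 i)|) * (C * activeSum xs (X (k + 1))) :=
    (dotProduct_le_sum_mul_norm (fun i => deriv θ (X 1 i)) _).trans
      (mul_le_mul_of_nonneg_left (hCle _ hXK) (by positivity))
  have h3 : k * (σ / 2 * activeSum xs (X (k + 1))) ≤
      ∑ j ∈ Finset.range k, v (Y (j + 1)) ⬝ᵥ (X (k + 1) - xs) := by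
    have := Finset.card_nsmul_le_sum (Finset.range k)
      (fun j => v (Y (j + 1)) ⬝ᵥ (X (k + 1) - xs)) (σ / 2 * activeSum xs (X (k + 1)))
      fun j _ => hdrift (j + 1) (Nat.le_add_left 1 j) _ hXK
    simpa using this
  have h4 := mul_le_mul_of_nonneg_left h3 hγ.le
  have h5 : γ * σ / 2 * activeSum xs (X (k + 1)) ≤
      |γ * σ / 2| * activeSum xs (X (k + 1)) :=
    mul_le_mul_of_nonneg_right (le_abs_self _) (activeSum_nonneg hXK)
  push_cast
  linarith

end Convergence

/-! ### Rates for the entropy-like and power-like kernels. -/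

section Rates

variable {n : ℕ} {xs : Fin n → ℝ} {N : Seminorm ℝ (Fin n → ℝ)} {X : ℕ → (Fin n → ℝ)}
  {θ : ℝ → ℝ} {C M κ : ℝ}

theorem isBigO_exp_of_active_sum_le (hC : 0 ≤ C)
    (hN : ∀ t, 1 ≤ t → N (X t - xs) ≤ C * activeSum xs (X t))
    (hpos : ∀ t, 1 ≤ t → ∀ i, xs i = 0 → 0 < X t i ∧ X t i ≤ 1)
    (hsum : ∀ t : ℕ, 1 ≤ t → ∑ i with xs i = 0, X t i * deriv θ (X t i) ≤
      (M - κ * t / 2) * activeSum xs (X t))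
    (hθ : IsKernel θ) (hE : EntropyLike θ) :
    (fun t : ℕ => N (X t - xs)) =O[atTop] fun t : ℕ => Real.exp (-(κ * t / 2)) := by
  obtain ⟨B, hB⟩ := hE.exists_le_deriv hθ
  set S : Finset (Fin n) := {i | xs i = 0} with hS
  have hmem : ∀ i ∈ S, xs i = 0 := fun i hi => by simpa [hS] using hi
  refine IsBigO.of_bound (C * (S.card * Real.exp (M + B))) ?_
  filter_upwards [eventually_ge_atTop 1] with t ht
  rw [Real.norm_of_nonneg (apply_nonneg N _), Real.norm_of_nonneg (Real.exp_pos _).le]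
  have h1 : ∑ i ∈ S, X t i * Real.log (X t i) ≤ (M + B - κ * t / 2) * ∑ i ∈ S, X t i := by
    have h2 : ∑ i ∈ S, (X t i * Real.log (X t i) - B * X t i) ≤
        ∑ i ∈ S, X t i * deriv θ (X t i) := by
      refine Finset.sum_le_sum fun i hi => ?_
      obtain ⟨hp, hle⟩ := hpos t ht i (hmem i hi)
      have := mul_le_mul_of_nonneg_left (hB _ hp hle) hp.le
      linarith
    have h3 := hsum t ht
    rw [Finset.sum_sub_distrib, ← Finset.mul_sum] at h2
    rw [activeSum] at h3
    linarith
  have h4 := sum_le_card_mul_exp (fun i hi => (hpos t ht i (hmem i hi)).1) h1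
  calc N (X t - xs) ≤ C * ∑ i ∈ S, X t i := hN t ht
    _ ≤ C * (S.card * Real.exp (M + B - κ * t / 2)) := mul_le_mul_of_nonneg_left h4 hC
    _ = _ := by
      rw [sub_eq_add_neg, Real.exp_add]
      ring

theorem isBigO_rpow_of_active_sum_le (hC : 0 ≤ C) (hκ : 0 < κ)
    (hN : ∀ t, 1 ≤ t → N (X t - xs) ≤ C * activeSum xs (X t))
    (hpos : ∀ t, 1 ≤ t → ∀ i, xs i = 0 → 0 < X t i ∧ X t i ≤ 1)
    (hsum : ∀ t : ℕ, 1 ≤ t → ∑ i with xs i = 0, X t i * deriv θ (X t i) ≤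
      (M - κ * t / 2) * activeSum xs (X t))
    (hθ : IsKernel θ) {q : ℝ} (hq : 0 < q) (hq1 : q < 1) (hP : PowerLike θ q) :
    (fun t : ℕ => N (X t - xs)) =O[atTop] fun t : ℕ => (κ * t / 2) ^ (-1 / q) := by
  obtain ⟨B, hB0, hB⟩ := hP.exists_le_deriv hq hθ
  set S : Finset (Fin n) := {i | xs i = 0} with hS
  have hmem : ∀ i ∈ S, xs i = 0 := fun i hi => by simpa [hS] using hi
  refine IsBigO.of_bound (C * (2 * S.card * (1 / (4 * B)) ^ (-1 / q))) ?_
  -- From then on `R = κt/2 - M` is at least `κt/4`, hence positive.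
  have hlarge : ∀ᶠ t : ℕ in atTop, 2 * M ≤ κ * t / 2 := by
    filter_upwards [eventually_ge_atTop ⌈4 * M / κ⌉₊] with t ht
    have := (Nat.le_ceil _).trans (Nat.cast_le.2 ht)
    rw [div_le_iff₀ hκ] at this
    linarith
  filter_upwards [eventually_ge_atTop 1, hlarge] with t ht hMt
  have ht0 : (0 : ℝ) < t := by exact_mod_cast ht
  have hu : 0 < κ * t / 2 := by positivity
  rw [Real.norm_of_nonneg (apply_nonneg N _), Real.norm_of_nonneg (Real.rpow_nonneg hu.le _)]
  set R := κ * t / 2 - M with hR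
  have hRle : κ * t / 2 / 2 ≤ R := by linarith
  have hR0 : 0 < R := by linarith
  have h1 : ∑ i ∈ S, X t i * (-B * X t i ^ (-q)) ≤ -R * ∑ i ∈ S, X t i := by
    have h2 : ∑ i ∈ S, X t i * (-B * X t i ^ (-q)) ≤ ∑ i ∈ S, X t i * deriv θ (X t i) := by
      refine Finset.sum_le_sum fun i hi => ?_
      obtain ⟨hp, hle⟩ := hpos t ht i (hmem i hi)
      exact mul_le_mul_of_nonneg_left (hB _ hp hle) hp.le
    refine h2.trans ((hsum t ht).trans (le_of_eq ?_))
    rw [hR, activeSum]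
    ring
  have h4 := sum_le_card_mul_rpow (fun i hi => (hpos t ht i (hmem i hi)).1) hq hq1 hB0 hR0 h1
  have h5 : (R / (2 * B)) ^ (-1 / q) ≤ (1 / (4 * B)) ^ (-1 / q) * (κ * t / 2) ^ (-1 / q) := by
    rw [← Real.mul_rpow (by positivity) hu.le]
    refine Real.rpow_le_rpow_of_nonpos (by positivity) ?_
      (div_nonpos_of_nonpos_of_nonneg (by norm_num) hq.le)
    calc 1 / (4 * B) * (κ * t / 2) = κ * t / 2 / 2 / (2 * B) := by
          field_simp
          ring
      _ ≤ R / (2 * B) := by gcongr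
  calc N (X t - xs) ≤ C * ∑ i ∈ S, X t i := hN t ht
    _ ≤ C * (2 * S.card * ((1 / (4 * B)) ^ (-1 / q) * (κ * t / 2) ^ (-1 / q))) := by
        refine mul_le_mul_of_nonneg_left (h4.trans ?_) hC
        gcongr
    _ = _ := by ring

theorem tendsto_exp_neg_mul_div_two (hκ : 0 < κ) :
    Tendsto (fun t : ℕ => Real.exp (-(κ * t / 2))) atTop (𝓝 0) := by
  refine Real.tendsto_exp_neg_atTop_nhds_zero.comp ?_
  exact (tendsto_natCast_atTop_atTop.const_mul_atTop hκ).atTop_div_const two_pos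

theorem tendsto_rpow_neg_one_div (hκ : 0 < κ) {q : ℝ} (hq : 0 < q) :
    Tendsto (fun t : ℕ => (κ * t / 2) ^ (-1 / q)) atTop (𝓝 0) := by
  rw [neg_div]
  refine (tendsto_rpow_neg_atTop (one_div_pos.2 hq)).comp ?_
  exact (tendsto_natCast_atTop_atTop.const_mul_atTop hκ).atTop_div_const two_pos

end Rates

end Bregman

/-! ### Assembly: bounded against unbounded slope at zero. -/

theorem corollary2 {m n : ℕ}
    -- an arbitrary norm on `ℝⁿ`
    (N : Seminorm ℝ (Fin n → ℝ)) (hN : ∀ x, N x = 0 → x = 0)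
    -- the polyhedral domain, with a Slater point
    (A : Matrix (Fin m) (Fin n) ℝ) (c : Fin m → ℝ)
    (hSlater : ∃ x ∈ Bregman.polyhedron A c, ∀ i, 0 < x i)
    -- the vector field and the solution under study
    (v : (Fin n → ℝ) → (Fin n → ℝ)) (L : ℝ) (hL : 0 < L)
    (hLip : Bregman.IsLipschitzField N (Bregman.polyhedron A c) v L)
    (xs : Fin n → ℝ) (hsol : Bregman.IsVISolution (Bregman.polyhedron A c) v xs)
    (μ : ℝ) (hμ : 0 < μ)
    (hSOS : Bregman.SecondOrderSufficient N (Bregman.polyhedron A c) v xs μ)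
    -- sharpness of the solution
    (s : Fin n → ℝ) (hs : Bregman.IsSlackness A v xs s) (hsharp : Bregman.IsSharp A c xs s)
    -- the decomposable Bregman regularizer
    (h : (Fin n → ℝ) → ℝ) (gradh : (Fin n → ℝ) → (Fin n → ℝ)) (θ : ℝ → ℝ)
    (hreg : Bregman.IsRegularizer N (Bregman.polyhedron A c) h gradh)
    (hdec : Bregman.IsDecomposable (Bregman.polyhedron A c) h θ)
    -- the parameters of the method
    (a b : ℝ) (ha : a ∈ Set.Icc (0 : ℝ) 1) (hb : b ∈ Set.Icc (0 : ℝ) 1) (hab : a + b ≤ 1)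
    (hab' : 0 < b → a + b = 1)
    (γ : ℝ) (hγ : 0 < γ) (hγ₁ : γ ≤ 1 / (2 * Real.goldenRatio * L))
    (hγ₂ : γ * (1 - a - b) ^ 2 ≤ μ / (8 * L ^ 2)) :
    ∃ δ : ℝ, 0 < δ ∧ ∀ X Y : ℕ → (Fin n → ℝ),
      Bregman.IsBPM (Bregman.polyhedron A c) h gradh v γ a b X Y → N (X 1 - xs) ≤ δ →
      ((Bregman.EuclideanLike θ ∨ Bregman.EntropyLike θ ∨
          ∃ q : ℝ, 0 < q ∧ q < 1 ∧ Bregman.PowerLike θ q) →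
        Tendsto (fun t => N (X t - xs)) atTop (𝓝 0)) ∧
      (Bregman.EuclideanLike θ → ∃ T : ℕ, 1 ≤ T ∧ ∀ t, T ≤ t → N (X t - xs) = 0) ∧
      (Bregman.EntropyLike θ →
        (fun t : ℕ => N (X t - xs)) =O[atTop]
          fun t : ℕ => Real.exp (-(γ * Bregman.sharpness xs s * t / 2))) ∧
      (∀ q : ℝ, 0 < q → q < 1 → Bregman.PowerLike θ q →
        (fun t : ℕ => N (X t - xs)) =O[atTop]
          fun t : ℕ => (γ * Bregman.sharpness xs s * t / 2) ^ (-1 / q)) := by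
  open Bregman in
  -- The golden ratio enters only through `φ ≥ 3/2`.
  have hγL : γ * L ≤ 1 / 3 := by
    have h5 : (2 : ℝ) ≤ √5 := Real.le_sqrt_of_sq_le (by norm_num)
    have hφ : 3 / 2 ≤ Real.goldenRatio := by
      rw [Real.goldenRatio]
      linarith
    have hφ0 := Real.goldenRatio_pos
    rw [le_div_iff₀ (by positivity)] at hγ₁
    have h6 : γ * L * 3 ≤ γ * L * (2 * Real.goldenRatio) := by
      gcongr
      linarith
    linarith
  have hfinite : ∀ X : ℕ → (Fin n → ℝ), (∀ t, 2 ≤ t → X t = xs) →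
      (fun t => N (X t - xs)) =ᶠ[atTop] 0 := fun X hX => by
    filter_upwards [eventually_ge_atTop 2] with t ht
    simp [hX t ht]
  have hdone : ∀ X : ℕ → (Fin n → ℝ), (∀ t, 2 ≤ t → X t = xs) →
      ((EuclideanLike θ ∨ EntropyLike θ ∨ ∃ q : ℝ, 0 < q ∧ q < 1 ∧ PowerLike θ q) →
        Tendsto (fun t => N (X t - xs)) atTop (𝓝 0)) ∧
      (EuclideanLike θ → ∃ T : ℕ, 1 ≤ T ∧ ∀ t, T ≤ t → N (X t - xs) = 0) ∧
      (EntropyLike θ → (fun t : ℕ => N (X t - xs)) =O[atTop]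
          fun t : ℕ => Real.exp (-(γ * sharpness xs s * t / 2))) ∧
      (∀ q : ℝ, 0 < q → q < 1 → PowerLike θ q → (fun t : ℕ => N (X t - xs)) =O[atTop]
          fun t : ℕ => (γ * sharpness xs s * t / 2) ^ (-1 / q)) := fun X hX =>
    ⟨fun _ => (tendsto_congr' (hfinite X hX)).2 tendsto_const_nhds,
      fun _ => ⟨2, one_le_two, fun t ht => by simp [hX t ht]⟩,
      fun _ => (hfinite X hX).trans_isBigO (isBigO_zero _ _),
      fun _ _ _ _ => (hfinite X hX).trans_isBigO (isBigO_zero _ _)⟩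
  by_cases hact : ∃ i, xs i = 0
  swap
  · push Not at hact
    exact ⟨1, one_pos, fun X Y hXY _ => hdone X fun t ht =>
      eq_of_forall_ne_zero hsharp.2 hact
        (mem_of_mem_proxDom (hXY.mem_proxDom (one_le_two.trans ht)))⟩
  have hσ := hsharp.sharpness_pos hact
  set σ := sharpness xs s with hσdef
  have hsel := hdec.isMaximalSelection hSlater hreg
  obtain ⟨C, hC, hCle⟩ := exists_norm_sub_le_activeSum hsharp.2
  obtain ⟨C₁, hC₁, hC₁le⟩ := exists_seminorm_le N
  obtain ⟨C₂, hC₂, hC₂le⟩ := exists_norm_le hN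
  have hNle : ∀ x ∈ polyhedron A c, N (x - xs) ≤ C₁ * C * activeSum xs x := fun x hx => by
    rw [mul_assoc]
    exact (hC₁le _).trans (mul_le_mul_of_nonneg_left (hCle x hx) hC₁.le)
  have hstable : ∀ r, 0 < r → ∃ δ, 0 < δ ∧ ∀ X Y : ℕ → (Fin n → ℝ),
      IsBPM (polyhedron A c) h gradh v γ a b X Y → N (X 1 - xs) ≤ δ →
      ∀ t, 1 ≤ t → N (X t - xs) ≤ r ∧ N (Y t - xs) ≤ r := fun r hr => by
    obtain ⟨ε, hε, hεX⟩ := exists_energy_stability hN hLip hsol hSOS hreg hsel ha.1 hb.1 hab hL hγ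
      hγL hγ₂ hr
    obtain ⟨δ, hδ, hδx⟩ := exists_seminorm_ball_of_eventually hN
      ((hdec.tendsto_breg hSlater hreg hsol.1).eventually (ge_mem_nhds hε))
    exact ⟨δ, hδ, fun X Y hXY hX1 => hεX X Y hXY (hδx _ hXY.init_mem hX1)⟩
  -- Chosen so that `L r₀ C₁ C = σ/2`: the Lipschitz error costs half of the sharpness.
  set r₀ := σ / 2 / (L * (C₁ * C)) with hr₀
  have hr₀pos : 0 < r₀ := by positivity
  have hdrift : ∀ x ∈ polyhedron A c, ∀ y ∈ polyhedron A c, N (y - xs) ≤ r₀ →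
      σ / 2 * activeSum xs x ≤ v y ⬝ᵥ (x - xs) := fun x hx y hy hyr =>
    hsharp.half_sharpness_mul_activeSum_le hN hs hL hLip hNle hr₀pos.le
      (le_of_eq (by rw [hr₀, ← hσdef]; field_simp)) hx hy hyr
  -- Bounded slopes end the method from `t = 2` on, which settles all the claims; unbounded slopes
  -- exclude the Euclidean-like case.
  by_cases hθ : SlopeBounded θ
  · obtain ⟨r₁, hr₁, hstep⟩ := exists_base_step_eq (v := v) hN hreg hsel
      (hdec.mem_proxDom hsol.1 fun i => Or.inr hθ) hsharp.2 hγ hσ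
    obtain ⟨δ, hδ, hδX⟩ := hstable (min r₀ r₁) (lt_min hr₀pos hr₁)
    refine ⟨δ, hδ, fun X Y hXY hX1 => hdone X fun t ht => ?_⟩
    obtain ⟨k, rfl⟩ : ∃ k, t = k + 1 := ⟨t - 1, by omega⟩
    have hk : 1 ≤ k := by omega
    have hnear := hδX X Y hXY hX1
    have hp := hXY.base_step k hk
    exact hstep (X k) (hXY.mem_proxDom hk) (Y k) (X (k + 1))
      ((hnear k hk).1.trans (min_le_right _ _))
      ((hnear (k + 1) (Nat.le_add_left 1 k)).1.trans (min_le_right _ _)) hp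
      (hdrift _ hp.1 _ (hXY.lead_step k hk).1 ((hnear k hk).2.trans (min_le_left _ _)))
  · obtain ⟨ρ, hρ, hρ1, hρle⟩ := exists_pos_le_one_and_le_half hsol.1.1
    -- The radius `ρ / C₂` gives sup-norm distance at most `ρ ≤ 1`, so active coordinates stay in
    -- `(0, 1]`, where the bounds on `θ'` hold.
    obtain ⟨δ, hδ, hδX⟩ := hstable (min r₀ (ρ / C₂)) (lt_min hr₀pos (by positivity))
    refine ⟨δ, hδ, fun X Y hXY hX1 => ?_⟩
    have hnear := hδX X Y hXY hX1
    have hXρ : ∀ t, 1 ≤ t → ‖X t - xs‖ ≤ ρ := fun t ht =>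
      calc ‖X t - xs‖ ≤ C₂ * N (X t - xs) := hC₂le _
        _ ≤ C₂ * (ρ / C₂) :=
            mul_le_mul_of_nonneg_left ((hnear t ht).1.trans (min_le_right _ _)) hC₂.le
        _ = ρ := by field_simp
    have hpos : ∀ t, 1 ≤ t → ∀ i, xs i = 0 → 0 < X t i ∧ X t i ≤ 1 := fun t ht i hi => by
      refine ⟨hdec.pos_of_mem_proxDom hSlater hθ (hXY.mem_proxDom ht) i, ?_⟩
      have h1 := (le_abs_self _).trans ((norm_le_pi_norm (X t - xs) i).trans (hXρ t ht))
      rw [Pi.sub_apply, hi, sub_zero] at h1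
      exact h1.trans hρ1
    obtain ⟨M, -, hM⟩ := hXY.exists_active_sum_le hdec hSlater hθ hreg hsol.1 hC.le hCle hρle hγ
      hXρ fun t ht x hx => hdrift x hx _ (hXY.lead_step t ht).1
        ((hnear t ht).2.trans (min_le_left _ _))
    have hNX : ∀ t, 1 ≤ t → N (X t - xs) ≤ C₁ * C * activeSum xs (X t) := fun t ht =>
      hNle _ (mem_of_mem_proxDom (hXY.mem_proxDom ht))
    have hexp := isBigO_exp_of_active_sum_le (by positivity) hNX hpos hM hdec.1
    have hrpow := fun q hq hq1 => isBigO_rpow_of_active_sum_le (q := q) (by positivity)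
      (mul_pos hγ hσ) hNX hpos hM hdec.1 hq hq1
    have hEuclid : ¬ EuclideanLike θ := fun hE => hθ (hE.slopeBounded hdec.1)
    refine ⟨?_, fun hE => absurd hE hEuclid, hexp, hrpow⟩
    rintro (hE | hE | ⟨q, hq, hq1, hP⟩)
    · exact absurd hE hEuclid
    · exact (hexp hE).trans_tendsto (tendsto_exp_neg_mul_div_two (mul_pos hγ hσ))
    · exact (hrpow q hq hq1 hP).trans_tendsto (tendsto_rpow_neg_one_div (mul_pos hγ hσ) hq)
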